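/- Let $K$ be a field, let $\lambda=(\lambda_1\ge\lambda_2\ge\dots\ge\lambda_m)$ be a partition of $n$ with $\lambda_m>0$ and $m\ge 2$ (i.e. $\lambda\ne(n)$), and set $k=\min_{2\le i\le m}(\lambda_{i-1}-\lambda_i)$. Let $S=K[x_1,\dots,x_n]$. For a tableau $T$ of shape $\lambda$, i.e. a bijective filling of the Young diagram of $\lambda$ by $1,\dots,n$, let $f_T\in S$ be the product of all $x_a-x_b$ such that $a$ and $b$ are in the same column of $T$ and $b$ is in a lower position than $a$, and let $I_\lambda\subset S$ be the ideal generated by all $f_T$ with $T$ a tableau of shape $\lambda$. For a monomial order $<$ on $S$, let $\operatorname{in}_<(I_\lambda)$ be the ideal generated by the leading terms of the elements of $I_\lambda$. For $\sigma\in\mathfrak S_n$, let $\prec_\sigma$ be the lexicographic order on $S$ with $x_{\sigma(1)}\prec_\sigma x_{\sigma(2)}\prec_\sigma\cdots\prec_\sigma x_{\sigma(n)}$. Then: 1. As $<$ runs over all monomial orders on $S$, there are exactly $n!/(k+1)!$ distinct ideals $\operatorname{in}_<(I_\lambda)$. 2. The set of these ideals equals $\{\operatorname{in}_{\prec_\sigma}(I_\lambda)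 : \sigma\in\mathfrak S_n\}$. 3. For $\sigma,\tau\in\mathfrak S_n$, one has $\operatorname{in}_{\prec_\sigma}(I_\lambda)=\operatorname{in}_{\prec_\tau}(I_\lambda)$ if and only if $\sigma(i)=\tau(i)$ for all $1\le i\le n-k-1$, i.e. $\sigma$ and $\tau$ agree up to permuting the values $\sigma(n-k),\dots,\sigma(n)$. -/

import Mathlib

/-- The boxes of the diagram whose `i`-th row (rows are numbered `0, …, m - 1` from the top)
has `l i` boxes; the box `⟨i, j⟩` lies in row `i` and column `j`. -/
abbrev DiagramBox {m : ℕ} (l : Fin m → ℕ) : Type := (i : Fin m) × Fin (l i)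

/-- A Young tableau: a bijective filling of the boxes of the diagram with row lengths `l`
by the `n` elements of `Fin n`. -/
abbrev YoungTableau {m : ℕ} (l : Fin m → ℕ) (n : ℕ) : Type := DiagramBox l ≃ Fin n

/-- The Specht polynomial `f_T` of a tableau `T`: the product of all `x_a - x_b` such that
`a` and `b` are in the same column of `T` and `b` is in a lower position than `a`. -/
noncomputable def spechtPolynomial (K : Type*) [Field K] {m n : ℕ} {l : Fin m → ℕ}
    (T : YoungTableau l n) : MvPolynomial (Fin n) K :=
  ∏ p : DiagramBox l × DiagramBox l with (p.1.2 : ℕ) = (p.2.2 : ℕ) ∧ p.1.1 < p.2.1,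
    (MvPolynomial.X (T p.1) - MvPolynomial.X (T p.2))

/-- The Specht ideal `I_l` of `K[x_0, …, x_{n-1}]`, generated by the Specht polynomials of all
tableaux of shape `l`. -/
noncomputable def spechtIdeal (K : Type*) [Field K] {m : ℕ} (l : Fin m → ℕ) (n : ℕ) :
    Ideal (MvPolynomial (Fin n) K) :=
  Ideal.span (Set.range fun T : YoungTableau l n => spechtPolynomial K T)

/-- The initial ideal of `I` with respect to the monomial order `M`: the ideal generated by the
leading terms of the elements of `I`. -/
noncomputable def initialIdeal {n : ℕ} {K : Type*} [Field K] (M : MonomialOrder (Fin n))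
    (I : Ideal (MvPolynomial (Fin n) K)) : Ideal (MvPolynomial (Fin n) K) :=
  Ideal.span (M.leadingTerm '' (I : Set (MvPolynomial (Fin n) K)))

/-- The lexicographic monomial order with `x_{σ 0} ≺ x_{σ 1} ≺ ⋯ ≺ x_{σ (n-1)}`.
Mathlib's `Lex` compares the exponent with the smallest index first, so the exponent vector `a`
is reindexed as `i ↦ a (σ (n - 1 - i))`. -/
noncomputable def lexOrderOfPerm {n : ℕ} (σ : Equiv.Perm (Fin n)) : MonomialOrder (Fin n) where
  syn := Lex (Fin n →₀ ℕ)
  toSyn := (Finsupp.domCongr (σ.symm.trans Fin.revPerm)).trans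
    { toEquiv := toLex
      map_add' := toLex_add }
  toSyn_monotone := by
    intro a b hab
    exact Finsupp.toLex_monotone (a := Finsupp.equivMapDomain (σ.symm.trans Fin.revPerm) a)
      (b := Finsupp.equivMapDomain (σ.symm.trans Fin.revPerm) b) (fun i => hab _)

/-- `a ≺ b` in `lexOrderOfPerm σ` if and only if the largest variable in which the monomials
`x^a` and `x^b` differ has the larger exponent in `x^b`. -/
theorem lexOrderOfPerm_lt_iff {n : ℕ} (σ : Equiv.Perm (Fin n)) (a b : Fin n →₀ ℕ) :
    (lexOrderOfPerm σ).toSyn a < (lexOrderOfPerm σ).toSyn b ↔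
      ∃ i : Fin n, (∀ j : Fin n, i < j → a (σ j) = b (σ j)) ∧ a (σ i) < b (σ i) := by
  have key : ∀ (c : Fin n →₀ ℕ) (i : Fin n),
      (Finsupp.domCongr (σ.symm.trans Fin.revPerm) c) i = c (σ i.rev) := by
    intro c i
    simp
  change toLex (Finsupp.domCongr (σ.symm.trans Fin.revPerm) a) <
    toLex (Finsupp.domCongr (σ.symm.trans Fin.revPerm) b) ↔ _
  rw [Finsupp.Lex.lt_iff]
  simp only [ofLex_toLex, key]
  constructor
  · rintro ⟨i, h1, h2⟩
    refine ⟨i.rev, fun j hj => ?_, h2⟩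
    have := h1 j.rev (by simpa using Fin.rev_lt_rev.mpr hj)
    simpa using this
  · rintro ⟨i, h1, h2⟩
    refine ⟨i.rev, fun j hj => h1 _ ?_, by simpa using h2⟩
    simpa using Fin.rev_lt_rev.mpr hj

/-! Up to sign, f_T depends only on how T distributes the variables over its columns, so it is a
`colorPoly`: a product of Vandermonde products over the classes of a colouring. The proof works with
the larger family of colourings for which the conjugate of the partition of class sizes is at most λ
in the dominance order (`IsDominated`).

Their polynomials all lie in I_λ. Lagrange interpolation writes such a polynomial as a combination
of those obtained by moving one element from a class to a class smaller by at least 2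
(`colorPoly_mem_of_update_mem`), and such moves lead to class sizes equal to the column lengths of λ
(`colorPoly_mem_of_truncSum_le`).

They form a Gröbner basis. The leading exponent of x_i in a `colorPoly` is the height of i in its
class, and it depends only on the order of the variables. Conversely, let f ≠ 0 in I_λ have
lexicographic leading exponent e. Choosing coordinates one variable at a time yields a point where f
does not vanish and where earlier values are repeated as often as e permits
(`exists_aeval_ne_zero`). Colouring each coordinate by the number of earlier repetitions of its
value gives heights at most e, and the colouring is dominated because some f_T is nonzero at the
point (`isDominated_wordColoring`). Hence the lexicographic initial ideal is contained in the
initial ideal of every order that sorts the variables alike. Initial ideals of one ideal are never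
properly contained in each other, so they are equal, which gives the second claim.

For the third claim, a dominated colouring can be changed, without increasing heights, so that the k
+ 1 largest variables have distinct colours (`exists_injOn_recoloring`); their mutual order is then
irrelevant. If σ and τ first differ at a position p that is not among the last k + 1, a ballot word
read along σ gives a leading exponent whose prefix along τ violates a counting inequality satisfied
by all heights (`not_subset_of_isSeparating`, `card_filter_le_mul`). Only p = 1 with two rows needs
its own argument (`not_subset_of_two_rows`). The first claim counts the classes of permutations so
obtained. -/

/-! ### Products of differences over colour classes, and straightening -/

/-- The product of the differences `x_i - x_j` over all pairs of indices of the same colour,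
oriented by increasing rank. -/
noncomputable def colorPoly (K : Type*) [Field K] {ι γ : Type*} [Fintype ι] [DecidableEq γ]
    (c : ι → γ) (ρ : ι → ℕ) : MvPolynomial ι K :=
  ∏ p : ι × ι with c p.1 = c p.2 ∧ ρ p.1 < ρ p.2, (MvPolynomial.X p.1 - MvPolynomial.X p.2)

theorem associates_mk_X_sub_X_comm {K ι : Type*} [Field K] (i j : ι) :
    Associates.mk (MvPolynomial.X i - MvPolynomial.X j : MvPolynomial ι K) =
      Associates.mk (MvPolynomial.X j - MvPolynomial.X i) := by
  rw [Associates.mk_eq_mk_iff_associated]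
  exact ⟨-1, by simp⟩

theorem X_sub_X_ne_zero {K ι : Type*} [Field K] {i j : ι} (h : i ≠ j) :
    (MvPolynomial.X i - MvPolynomial.X j : MvPolynomial ι K) ≠ 0 := by
  rw [sub_ne_zero]
  exact fun e => h (MvPolynomial.X_injective e)

section ColorPoly

variable {K : Type*} [Field K] {ι γ : Type*} [Fintype ι] [DecidableEq γ]

theorem colorPoly_ne_zero (c : ι → γ) (ρ : ι → ℕ) : colorPoly K c ρ ≠ 0 := by
  refine Finset.prod_ne_zero_iff.2 fun p hp => X_sub_X_ne_zero ?_
  rintro h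
  simp [h] at hp

theorem colorPoly_associated (c : ι → γ) {ρ ρ' : ι → ℕ}
    (h : ∀ i j, c i = c j → ρ i = ρ j → i = j) (h' : ∀ i j, c i = c j → ρ' i = ρ' j → i = j) :
    Associated (colorPoly K c ρ) (colorPoly K c ρ') := by
  rw [← Associates.mk_eq_mk_iff_associated, colorPoly, colorPoly, ← Associates.finsetProd_mk,
    ← Associates.finsetProd_mk]
  refine Finset.prod_bij' (fun p _ => if ρ' p.1 < ρ' p.2 then p else p.swap)
    (fun p _ => if ρ p.1 < ρ p.2 then p else p.swap) ?_ ?_ ?_ ?_ ?_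
  · rintro ⟨i, j⟩ hp
    simp only [Finset.mem_filter, Finset.mem_univ, true_and] at hp ⊢
    split_ifs with h1
    · exact ⟨hp.1, h1⟩
    · refine ⟨hp.1.symm, lt_of_le_of_ne (not_lt.1 h1) fun e => ?_⟩
      have := h' _ _ hp.1 e.symm
      simp [this] at hp
  · rintro ⟨i, j⟩ hp
    simp only [Finset.mem_filter, Finset.mem_univ, true_and] at hp ⊢
    split_ifs with h1
    · exact ⟨hp.1, h1⟩
    · refine ⟨hp.1.symm, lt_of_le_of_ne (not_lt.1 h1) fun e => ?_⟩
      have := h _ _ hp.1 e.symm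
      simp [this] at hp
  · rintro ⟨i, j⟩ hp
    simp only [Finset.mem_filter, Finset.mem_univ, true_and] at hp ⊢
    by_cases h1 : ρ' i < ρ' j
    · simp [h1, hp.2]
    · simp [h1, hp.2.not_gt]
  · rintro ⟨i, j⟩ hp
    simp only [Finset.mem_filter, Finset.mem_univ, true_and] at hp ⊢
    by_cases h1 : ρ i < ρ j
    · simp [h1, hp.2]
    · simp [h1, hp.2.not_gt]
  · rintro ⟨i, j⟩ hp
    dsimp only
    split_ifs with h1
    · rfl
    · exact associates_mk_X_sub_X_comm _ _

variable [DecidableEq ι]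

/-- The part of `colorPoly K c ρ` that involves the variable `x_y`, split off. -/
theorem colorPoly_associated_mul (c : ι → γ) {ρ : ι → ℕ} (hρ : Function.Injective ρ) (y : ι) :
    Associated (colorPoly K c ρ)
      ((∏ p : ι × ι with (c p.1 = c p.2 ∧ ρ p.1 < ρ p.2) ∧ (p.1 ≠ y ∧ p.2 ≠ y),
        (MvPolynomial.X p.1 - MvPolynomial.X p.2)) *
      ∏ z : ι with c z = c y ∧ z ≠ y, (MvPolynomial.X y - MvPolynomial.X z)) := by
  rw [colorPoly, ← Finset.prod_filter_mul_prod_filter_not _ (fun p : ι × ι => p.1 ≠ y ∧ p.2 ≠ y),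
    Finset.filter_filter, Finset.filter_filter]
  refine Associated.mul_left _ ?_
  rw [← Associates.mk_eq_mk_iff_associated, ← Associates.finsetProd_mk, ← Associates.finsetProd_mk]
  refine Finset.prod_bij' (fun p _ => if p.1 = y then p.2 else p.1)
    (fun z _ => if ρ y < ρ z then (y, z) else (z, y)) ?_ ?_ ?_ ?_ ?_
  · rintro ⟨i, j⟩ hp
    simp only [Finset.mem_filter, Finset.mem_univ, true_and] at hp ⊢
    split_ifs with h1
    · subst h1
      refine ⟨hp.1.1.symm, ?_⟩
      rintro rfl
      simp at hp
    · have : j = y := by tauto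
      subst this
      exact ⟨hp.1.1, h1⟩
  · rintro z hz
    simp only [Finset.mem_filter, Finset.mem_univ, true_and] at hz ⊢
    split_ifs with h1
    · simp [h1, hz.1]
    · have : ρ z ≠ ρ y := fun e => hz.2 (hρ e)
      simp only [hz.1, true_and]
      exact ⟨by omega, by simp⟩
  · rintro ⟨i, j⟩ hp
    simp only [Finset.mem_filter, Finset.mem_univ, true_and] at hp ⊢
    split_ifs with h1 h2 h2
    · simp [h1]
    · subst h1; exact absurd hp.1.2 h2
    · have : j = y := by tauto
      subst this
      exact absurd hp.1.2 h2.not_gt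
    · have : j = y := by tauto
      rw [this]
  · rintro z hz
    simp only [Finset.mem_filter, Finset.mem_univ, true_and] at hz ⊢
    by_cases h1 : ρ y < ρ z
    · simp [h1]
    · simp [h1, hz.2]
  · rintro ⟨i, j⟩ hp
    simp only [Finset.mem_filter, Finset.mem_univ, true_and] at hp ⊢
    split_ifs with h1
    · rw [h1]
    · have : j = y := by tauto
      rw [this, associates_mk_X_sub_X_comm]

/-- Recolouring y leaves all factors without x_y unchanged. The factors with x_y run over the old
class before the move and over the class of b after it, so multiplying each side by the factors of
the other side balances them up to sign. -/
theorem colorPoly_update_associated (c : ι → γ) {ρ : ι → ℕ} (hρ : Function.Injective ρ)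
    (y : ι) {b : γ} (hb : c y ≠ b) :
    Associated
      (colorPoly K c ρ * ∏ z : ι with c z = b, (MvPolynomial.X y - MvPolynomial.X z))
      (colorPoly K (Function.update c y b) ρ *
        ∏ z : ι with c z = c y ∧ z ≠ y, (MvPolynomial.X y - MvPolynomial.X z)) := by
  have h1 := colorPoly_associated_mul (K := K) c hρ y
  have h2 := colorPoly_associated_mul (K := K) (Function.update c y b) hρ y
  have e1 : (Finset.univ.filter fun z => Function.update c y b z = Function.update c y b y ∧ z ≠ y)
      = Finset.univ.filter fun z => c z = b := by
    ext z
    by_cases hz : z = y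
    · subst hz; simp [hb]
    · simp [hz]
  have e2 : (Finset.univ.filter fun p : ι × ι =>
        (Function.update c y b p.1 = Function.update c y b p.2 ∧ ρ p.1 < ρ p.2) ∧
          (p.1 ≠ y ∧ p.2 ≠ y))
      = Finset.univ.filter fun p : ι × ι =>
        (c p.1 = c p.2 ∧ ρ p.1 < ρ p.2) ∧ (p.1 ≠ y ∧ p.2 ≠ y) := by
    ext p
    simp only [Finset.mem_filter, Finset.mem_univ, true_and]
    constructor <;> rintro ⟨h, h', h''⟩ <;> simp_all
  rw [e1, e2] at h2
  refine (h1.mul_right _).trans ?_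
  refine Associated.trans ?_ (h2.mul_right _).symm
  exact .of_eq (mul_right_comm _ _ _)

open Polynomial in
/-- Straightening for two colour classes: if the class of `a` has at least two more elements than
the class of `b`, then `colorPoly K c ρ` lies in the ideal generated by the polynomials obtained by
recolouring one element of the class of `a` by `b`. -/
theorem colorPoly_mem_of_update_mem (I : Ideal (MvPolynomial ι K)) (c : ι → γ) {ρ : ι → ℕ}
    (hρ : Function.Injective ρ) {a b : γ}
    (hab : (Finset.univ.filter fun z => c z = b).card + 2 ≤
      (Finset.univ.filter fun z => c z = a).card)
    (h : ∀ y, c y = a → colorPoly K (Function.update c y b) ρ ∈ I) : colorPoly K c ρ ∈ I := by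
  have hne : a ≠ b := by
    rintro rfl
    omega
  set A := Finset.univ.filter fun z => c z = a with hA
  set B := Finset.univ.filter fun z => c z = b with hB
  let F := FractionRing (MvPolynomial ι K)
  let φ : MvPolynomial ι K →+* F := algebraMap _ _
  have hφ : Function.Injective φ := IsFractionRing.injective _ _
  let v : ι → F := fun i => φ (MvPolynomial.X i)
  have hv : Function.Injective v := hφ.comp MvPolynomial.X_injective
  -- P is monic of degree |A| - 1, so its leading coefficient 1 is the Lagrange sum of P(x_y) / ∏
  -- (x_y - x_z) over the nodes y in A. The value P(x_y) supplies exactly the product over B that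
  -- turns `c` into its recolouring at y. The power of X needs |B| ≤ |A| - 1.
  let P : F[X] := X ^ (A.card - 1 - B.card) * ∏ z ∈ B, (X - C (v z))
  have hPm : P.Monic := (monic_X_pow _).mul (monic_prod_of_monic _ _ fun z _ => monic_X_sub_C _)
  have hPd : P.natDegree = A.card - 1 := by
    rw [(monic_X_pow _).natDegree_mul (monic_prod_of_monic _ _ fun z _ => monic_X_sub_C _),
      natDegree_X_pow, natDegree_prod_of_monic _ _ fun z _ => monic_X_sub_C _]
    simp only [natDegree_X_sub_C, Finset.sum_const, smul_eq_mul, mul_one]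
    omega
  have key := Lagrange.leadingCoeff_eq_sum (s := A) (v := v) hv.injOn (P := P) (by
    rw [degree_eq_natDegree hPm.ne_zero, hPd]
    norm_cast
    omega)
  rw [hPm.leadingCoeff] at key
  have hu : ∀ y ∈ A, ∃ u : MvPolynomial ι K, colorPoly K c ρ *
      ∏ z ∈ B, (MvPolynomial.X y - MvPolynomial.X z) =
      u * colorPoly K (Function.update c y b) ρ *
        ∏ z ∈ A.erase y, (MvPolynomial.X y - MvPolynomial.X z) := by
    intro y hy
    have hya : c y = a := by simpa [hA] using hy
    obtain ⟨u, hu⟩ := (colorPoly_update_associated (K := K) c hρ y (b := b) (by rwa [hya])).symm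
    have e : (Finset.univ.filter fun z => c z = c y ∧ z ≠ y) = A.erase y := by
      ext z
      simp [hA, hya, and_comm]
    rw [e] at hu
    exact ⟨u, by rw [← hu]; ring⟩
  choose! u hu using hu
  have main : colorPoly K c ρ = ∑ y ∈ A, MvPolynomial.X y ^ (A.card - 1 - B.card) * u y *
      colorPoly K (Function.update c y b) ρ := by
    apply hφ
    rw [← mul_one (φ (colorPoly K c ρ)), key, Finset.mul_sum, map_sum]
    refine Finset.sum_congr rfl fun y hy => ?_
    have h0 : ∏ z ∈ A.erase y, (v y - v z) ≠ 0 := by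
      refine Finset.prod_ne_zero_iff.2 fun z hz => sub_ne_zero.2 fun e => ?_
      exact (Finset.ne_of_mem_erase hz) (hv e).symm
    rw [mul_div_assoc', div_eq_iff h0]
    have h1 := congrArg φ (hu y hy)
    simp only [map_mul, map_prod, map_sub] at h1
    simp only [P, eval_mul, eval_pow, eval_X, eval_prod, eval_sub, eval_C, map_mul, map_pow]
    rw [mul_left_comm, h1]
    ring
  rw [main]
  refine Ideal.sum_mem _ fun y hy => Ideal.mul_mem_left _ _ (h y ?_)
  simpa [hA] using hy

end ColorPoly

/-! ### Dominance order of conjugate partitions through truncated sums -/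

/-- The sum of the entries of `p`, each truncated at `t`. -/
def truncSum {γ : Type*} [Fintype γ] (p : γ → ℕ) (t : ℕ) : ℕ := ∑ j, min (p j) t

/-- The number of elements of colour `j`. -/
def colorCard {ι γ : Type*} [Fintype ι] [DecidableEq γ] (c : ι → γ) (j : γ) : ℕ :=
  (Finset.univ.filter fun i => c i = j).card

section Majorization

variable {γ : Type*} [Fintype γ]

theorem truncSum_zero (p : γ → ℕ) : truncSum p 0 = 0 := by simp [truncSum]

theorem truncSum_succ (p : γ → ℕ) (t : ℕ) :
    truncSum p (t + 1) = truncSum p t + (Finset.univ.filter fun j => t < p j).card := by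
  rw [truncSum, truncSum, Finset.card_filter, ← Finset.sum_add_distrib]
  refine Finset.sum_congr rfl fun j _ => ?_
  split_ifs <;> omega

theorem truncSum_eq_sum (p : γ → ℕ) {t : ℕ} (h : ∀ j, p j ≤ t) : truncSum p t = ∑ j, p j :=
  Finset.sum_congr rfl fun j _ => min_eq_left (h j)

theorem truncSum_le_sum (p : γ → ℕ) (t : ℕ) : truncSum p t ≤ ∑ j, p j :=
  Finset.sum_le_sum fun _ _ => min_le_left _ _

theorem card_filter_le_eq (p : γ → ℕ) (s : ℕ) :
    (Finset.univ.filter fun j => s ≤ p j).card =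
      (Finset.univ.filter fun j => p j = s).card + (Finset.univ.filter fun j => s < p j).card := by
  classical
  rw [← Finset.card_union_of_disjoint]
  · congr 1
    ext j
    simp only [Finset.mem_filter, Finset.mem_univ, true_and, Finset.mem_union]
    omega
  · rw [Finset.disjoint_filter]
    intro j _ h1 h2
    omega

variable {p q : γ → ℕ}

/-- The increments of `truncSum` are the parts of the conjugate partition. If the sums agree at s
and those of `p` are no larger at s - 1, the last increment of `p` is at least that of `q`. -/
theorem card_filter_le_of_truncSum_eq (h : ∀ t, truncSum p t ≤ truncSum q t) {s : ℕ}
    (hs : truncSum p s = truncSum q s) :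
    (Finset.univ.filter fun j => s ≤ q j).card ≤ (Finset.univ.filter fun j => s ≤ p j).card := by
  rcases s with _ | s
  · simp
  · have h1 := truncSum_succ p s
    have h2 := truncSum_succ q s
    have h3 := h s
    simp only [Nat.succ_le_iff]
    omega

/-- At a point of agreement, the increment into s is at least as large for `p` and the increment out
of s is at most as large. The number of entries equal to s is the difference of these two
increments. -/
theorem card_filter_eq_le_of_truncSum_eq (h : ∀ t, truncSum p t ≤ truncSum q t) {s : ℕ}
    (hs : truncSum p s = truncSum q s) :
    (Finset.univ.filter fun j => q j = s).card ≤ (Finset.univ.filter fun j => p j = s).card := by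
  have h1 := card_filter_le_of_truncSum_eq h hs
  rw [card_filter_le_eq, card_filter_le_eq] at h1
  have h2 := truncSum_succ p s
  have h3 := truncSum_succ q s
  have h4 := h (s + 1)
  omega

theorem exists_eq_of_truncSum_lt_succ (h : ∀ t, truncSum p t ≤ truncSum q t) {s : ℕ}
    (hs : truncSum p s = truncSum q s) (hs' : truncSum p (s + 1) < truncSum q (s + 1)) :
    ∃ j, p j = s := by
  have h1 := card_filter_le_of_truncSum_eq h hs
  rw [card_filter_le_eq, card_filter_le_eq] at h1
  have h2 := truncSum_succ p s
  have h3 := truncSum_succ q s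
  have : 0 < (Finset.univ.filter fun j => p j = s).card := by omega
  obtain ⟨j, hj⟩ := Finset.card_pos.1 this
  exact ⟨j, by simpa using hj⟩

theorem exists_eq_succ_of_truncSum_lt (h : ∀ t, truncSum p t ≤ truncSum q t) {w : ℕ}
    (hw : truncSum p w < truncSum q w) (hw' : truncSum p (w + 1) = truncSum q (w + 1)) :
    ∃ j, p j = w + 1 := by
  have h1 := truncSum_succ p w
  have h2 := truncSum_succ q w
  have h3 := truncSum_succ p (w + 1)
  have h4 := truncSum_succ q (w + 1)
  have h5 := h (w + 1 + 1)
  have h6 := card_filter_le_eq p (w + 1)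
  have h7 := card_filter_le_eq q (w + 1)
  simp only [Nat.succ_le_iff] at h6 h7
  have : 0 < (Finset.univ.filter fun j => p j = w + 1).card := by omega
  obtain ⟨j, hj⟩ := Finset.card_pos.1 this
  exact ⟨j, by simpa using hj⟩

/-- If `p` is strictly dominated by `q`, there is a maximal interval of strict domination; its end
points are values of `p`. -/
theorem exists_gap (h : ∀ t, truncSum p t ≤ truncSum q t) (hsum : ∑ j, p j = ∑ j, q j) {t₀ : ℕ}
    (ht₀ : truncSum p t₀ < truncSum q t₀) :
    ∃ a b, p b < t₀ ∧ t₀ < p a ∧ ∀ t, p b < t → t < p a → truncSum p t < truncSum q t := by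
  classical
  obtain ⟨N, hN⟩ : ∃ N, ∀ t, N ≤ t → truncSum p t = truncSum q t := by
    refine ⟨∑ j, p j + ∑ j, q j, fun t ht => ?_⟩
    rw [truncSum_eq_sum, truncSum_eq_sum, hsum]
    · intro j
      have := Finset.single_le_sum (f := q) (fun _ _ => Nat.zero_le _) (Finset.mem_univ j)
      omega
    · intro j
      have := Finset.single_le_sum (f := p) (fun _ _ => Nat.zero_le _) (Finset.mem_univ j)
      omega
  -- The interval runs from the last agreement s before t₀ to the first agreement u after it.
  -- Leaving an agreement forces `p` to take the value s, and re-entering one forces it to take the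
  -- value u.
  have hex : ∃ u, t₀ < u ∧ truncSum p u = truncSum q u :=
    ⟨max N (t₀ + 1), by omega, hN _ (le_max_left _ _)⟩
  obtain ⟨hu1, hu2⟩ := Nat.find_spec hex
  have hu3 : ∀ t, t₀ ≤ t → t < Nat.find hex → truncSum p t < truncSum q t := by
    intro t h1 h2
    rcases h1.eq_or_lt with rfl | h1
    · exact ht₀
    · have := Nat.find_min hex h2
      exact lt_of_le_of_ne (h t) fun e => this ⟨h1, e⟩
  set u := Nat.find hex
  let P : ℕ → Prop := fun s => truncSum p s = truncSum q s
  have hP0 : P 0 := by simp [P, truncSum_zero]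
  have hs1 : P (Nat.findGreatest P t₀) := Nat.findGreatest_spec (Nat.zero_le _) hP0
  have hs2 : Nat.findGreatest P t₀ < t₀ := by
    refine lt_of_le_of_ne (Nat.findGreatest_le _) fun e => ?_
    rw [e] at hs1
    exact ht₀.ne hs1
  have hs3 : ∀ t, Nat.findGreatest P t₀ < t → t ≤ t₀ → truncSum p t < truncSum q t := by
    intro t h1 h2
    exact lt_of_le_of_ne (h t) (Nat.findGreatest_is_greatest (P := P) h1 h2)
  set s := Nat.findGreatest P t₀
  obtain ⟨b, hb⟩ := exists_eq_of_truncSum_lt_succ h hs1 (hs3 _ (by omega) (by omega))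
  obtain ⟨w, hw⟩ : ∃ w, u = w + 1 := ⟨u - 1, by omega⟩
  obtain ⟨a, ha⟩ := exists_eq_succ_of_truncSum_lt h (hu3 w (by omega) (by omega))
    (by rw [← hw]; exact hu2)
  refine ⟨a, b, by omega, by omega, fun t h1 h2 => ?_⟩
  rcases le_total t t₀ with h3 | h3
  · exact hs3 t (by omega) h3
  · exact hu3 t h3 (by omega)

end Majorization

/-! ### Moving elements between colour classes -/

section Recolor

variable {ι γ : Type*} [Fintype ι] [DecidableEq γ]

theorem sum_colorCard [Fintype γ] (c : ι → γ) : ∑ j, colorCard c j = Fintype.card ι := by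
  rw [← Finset.card_univ, Finset.card_eq_sum_card_fiberwise (f := c) (t := Finset.univ)]
  · rfl
  · simp

variable [DecidableEq ι]

theorem colorCard_update_self (c : ι → γ) {y : ι} {b : γ} (h : c y ≠ b) :
    colorCard (Function.update c y b) b = colorCard c b + 1 := by
  rw [colorCard, colorCard, ← Finset.card_insert_of_notMem (a := y) (by simpa using h)]
  congr 1
  ext z
  by_cases hz : z = y <;> simp [hz]

theorem colorCard_update_old (c : ι → γ) {y : ι} {b : γ} (h : c y ≠ b) :
    colorCard (Function.update c y b) (c y) + 1 = colorCard c (c y) := by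
  rw [colorCard, colorCard, ← Finset.card_erase_add_one (a := y) (s := {i | c i = c y}) (by simp)]
  congr 2
  ext z
  by_cases hz : z = y <;> simp [hz, h.symm]

theorem colorCard_update_of_ne (c : ι → γ) {y : ι} {b j : γ} (hj : j ≠ b) (hj' : j ≠ c y) :
    colorCard (Function.update c y b) j = colorCard c j := by
  rw [colorCard, colorCard]
  congr 1
  ext z
  by_cases hz : z = y
  · subst hz
    simp [hj.symm, hj'.symm]
  · simp [hz]

variable [Fintype γ]

/-- Moving an element to a smaller colour class increases the truncated sums between the two
class sizes by one. -/
theorem truncSum_colorCard_update (c : ι → γ) {y : ι} {b : γ} (h : c y ≠ b)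
    (hc : colorCard c b + 1 ≤ colorCard c (c y)) (t : ℕ) :
    truncSum (colorCard (Function.update c y b)) t = truncSum (colorCard c) t +
      if colorCard c b < t ∧ t < colorCard c (c y) then 1 else 0 := by
  have e : ∀ f : γ → ℕ, ∑ j, f j = f (c y) + (f b +
      ∑ j ∈ (Finset.univ.erase (c y)).erase b, f j) := by
    intro f
    rw [Finset.add_sum_erase _ f (by simpa using h.symm), Finset.add_sum_erase _ f (by simp)]
  rw [truncSum, truncSum, e, e (fun j => min (colorCard c j) t)]
  have : ∑ j ∈ (Finset.univ.erase (c y)).erase b, min (colorCard (Function.update c y b) j) t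
      = ∑ j ∈ (Finset.univ.erase (c y)).erase b, min (colorCard c j) t := by
    refine Finset.sum_congr rfl fun j hj => ?_
    simp only [Finset.mem_erase, Finset.mem_univ, and_true] at hj
    rw [colorCard_update_of_ne c hj.1 hj.2]
  rw [this]
  have h1 := colorCard_update_self c h
  have h2 := colorCard_update_old c h
  split_ifs <;> omega

/-- A colouring whose class sizes are dominated by `q` has its polynomial in every ideal that
contains the polynomials of the colourings with class sizes `q` (up to order). -/
theorem colorPoly_mem_of_truncSum_le {K : Type*} [Field K] (I : Ideal (MvPolynomial ι K))
    {ρ : ι → ℕ} (hρ : Function.Injective ρ) (q : γ → ℕ) (hq : ∑ j, q j = Fintype.card ι)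
    (hbase : ∀ c : ι → γ, (∀ t, truncSum (colorCard c) t = truncSum q t) → colorPoly K c ρ ∈ I)
    (c : ι → γ) (hc : ∀ t, truncSum (colorCard c) t ≤ truncSum q t) : colorPoly K c ρ ∈ I := by
  have hsum : ∀ c : ι → γ, ∑ j, colorCard c j = ∑ j, q j := fun c => by rw [sum_colorCard, hq]
  -- Induction on the total deficit of the truncated sums. The strict gap at t₀ has class sizes on
  -- both sides of t₀, so they differ by at least 2 and straightening applies; every recolouring
  -- lowers the deficit at t₀ and stays dominated throughout the gap.
  induction' hd : ∑ t ∈ Finset.range (Fintype.card ι + 1),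
    (truncSum q t - truncSum (colorCard c) t) using Nat.strong_induction_on with d ih generalizing c
  by_cases hall : ∀ t, truncSum (colorCard c) t = truncSum q t
  · exact hbase c hall
  push Not at hall
  obtain ⟨t₀, ht₀⟩ := hall
  obtain ⟨a, b, hb, ha, hgap⟩ := exists_gap hc (hsum c) (lt_of_le_of_ne (hc t₀) ht₀)
  have hle : colorCard c a ≤ Fintype.card ι := Finset.card_le_univ _
  have hne : a ≠ b := by
    rintro rfl
    omega
  refine colorPoly_mem_of_update_mem I c hρ (a := a) (b := b) (by simp only [colorCard] at *; omega)
    fun y hy => ?_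
  subst hy
  have hup := truncSum_colorCard_update c hne (by omega)
  have hc' : ∀ t, truncSum (colorCard (Function.update c y b)) t ≤ truncSum q t := by
    intro t
    rw [hup]
    split_ifs with h1
    · exact hgap t h1.1 h1.2
    · exact hc t
  refine ih _ ?_ _ hc' rfl
  rw [← hd]
  refine Finset.sum_lt_sum (fun t _ => ?_) ⟨t₀, by simp; omega, ?_⟩
  · rw [hup]
    omega
  · rw [hup, if_pos ⟨hb, ha⟩]
    have := hgap t₀ hb ha
    omega

end Recolor

/-! ### Diagrams, and Specht polynomials as colour polynomials -/

/-- The length of column `j` of the diagram with row lengths `l`. -/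
def colLength {m : ℕ} (l : Fin m → ℕ) (j : ℕ) : ℕ := (Finset.univ.filter fun i => j < l i).card

/-- The number of boxes in the first `t` rows. -/
def rowSum {m : ℕ} (l : Fin m → ℕ) (t : ℕ) : ℕ := ∑ i with i.val < t, l i

theorem exists_forall_iff_lt {m : ℕ} {P : Fin m → Prop} (hP : ∀ i j, i ≤ j → P j → P i) :
    ∃ c ≤ m, ∀ i, P i ↔ i.val < c := by
  classical
  refine ⟨(Finset.univ.filter P).card, (Finset.card_le_univ _).trans (by simp), fun i => ?_⟩
  constructor
  · intro hi
    have : Finset.Iic i ⊆ Finset.univ.filter P := fun j hj => by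
      simpa using hP _ _ (Finset.mem_Iic.1 hj) hi
    have := Finset.card_le_card this
    rw [Fin.card_Iic] at this
    omega
  · intro hi
    by_contra hn
    have : Finset.univ.filter P ⊆ Finset.Iio i := fun j hj => by
      rw [Finset.mem_Iio]
      by_contra hij
      exact hn (hP _ _ (not_lt.1 hij) (by simpa using hj))
    have := Finset.card_le_card this
    rw [Fin.card_Iio] at this
    omega

theorem card_filter_val_lt_and {m : ℕ} {P : Fin m → Prop} [DecidablePred P]
    (hP : ∀ i j, i ≤ j → P j → P i) (t : ℕ) :
    (Finset.univ.filter fun i : Fin m => i.val < t ∧ P i).card =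
      min (Finset.univ.filter P).card t := by
  have key : ∀ c ≤ m, (Finset.univ.filter fun i : Fin m => i.val < c).card = c := by
    intro c hc
    rw [Fin.card_filter_val_lt]
    exact min_eq_right hc
  obtain ⟨c, hc, h⟩ := exists_forall_iff_lt hP
  simp only [h]
  rw [key c hc, ← key (min c t) (by omega)]
  congr 1
  ext i
  simp [and_comm]

section Specht

variable {m n : ℕ} {l : Fin m → ℕ}

theorem le_of_sum_eq (hsum : ∑ i, l i = n) (i : Fin m) : l i ≤ n :=
  hsum ▸ Finset.single_le_sum (f := l) (fun _ _ => Nat.zero_le _) (Finset.mem_univ i)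

theorem rowSum_of_le (hsum : ∑ i, l i = n) {t : ℕ} (ht : m ≤ t) : rowSum l t = n := by
  rw [rowSum, Finset.filter_true_of_mem, hsum]
  exact fun i _ => i.2.trans_le ht

theorem rowSum_succ {t : ℕ} (ht : t < m) : rowSum l (t + 1) = rowSum l t + l ⟨t, ht⟩ := by
  have : (Finset.univ.filter fun i : Fin m => i.val < t + 1) =
      insert ⟨t, ht⟩ (Finset.univ.filter fun i : Fin m => i.val < t) := by
    ext i
    simp only [Finset.mem_filter, Finset.mem_univ, true_and, Finset.mem_insert, Fin.ext_iff]
    omega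
  rw [rowSum, this, Finset.sum_insert (by simp), add_comm, rowSum]

/-- Column j has min(its length, t) boxes in the first t rows; counting these boxes by rows instead
gives the right side. Dominance can thus be stated with row sums of λ. -/
theorem truncSum_colLength (hanti : Antitone l) (hsum : ∑ i, l i = n) (t : ℕ) :
    truncSum (fun j : Fin n => colLength l j) t = rowSum l t := by
  have h1 : ∀ j : Fin n, min (colLength l j) t =
      ∑ i with i.val < t, if j.val < l i then 1 else 0 := by
    intro j
    rw [colLength, ← card_filter_val_lt_and (fun a b hab hb => hb.trans_le (hanti hab)),
      ← Finset.card_filter, Finset.filter_filter]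
  simp only [truncSum, h1]
  rw [Finset.sum_comm, rowSum]
  refine Finset.sum_congr rfl fun i _ => ?_
  rw [← Finset.card_filter, Fin.card_filter_val_lt, min_eq_right (le_of_sum_eq hsum i)]

/-- The truncated sums of the class sizes of `c` are at most those of the columns of the
diagram. -/
def IsDominated {ι γ : Type*} [Fintype ι] [Fintype γ] [DecidableEq γ] (l : Fin m → ℕ)
    (c : ι → γ) : Prop :=
  ∀ t, truncSum (colorCard c) t ≤ rowSum l t

theorem spechtPolynomial_associated (K : Type*) [Field K] {γ : Type*} [DecidableEq γ]
    (T : YoungTableau l n) {c : Fin n → γ}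
    (hc : ∀ x y, c x = c y ↔ ((T.symm x).2 : ℕ) = (T.symm y).2) {ρ : Fin n → ℕ}
    (hρ : Function.Injective ρ) : Associated (spechtPolynomial K T) (colorPoly K c ρ) := by
  have h : spechtPolynomial K T = colorPoly K c fun x => (T.symm x).1 := by
    refine Finset.prod_equiv (T.prodCongr T) (fun p => ?_) (fun p _ => rfl)
    have e : ∀ b, ((T.symm (T b)).2 : ℕ) = b.2 := fun b =>
      congrArg (fun b : DiagramBox l => (b.2 : ℕ)) (T.symm_apply_apply b)
    simp [hc, e]
  rw [h]
  refine colorPoly_associated c (fun i j hij e => ?_) (fun i j _ e => hρ e)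
  rw [hc] at hij
  apply T.symm.injective
  rcases hi : T.symm i with ⟨r, a⟩
  rcases hj : T.symm j with ⟨r', a'⟩
  rw [hi, hj] at hij e
  obtain rfl : r = r' := Fin.ext e
  obtain rfl : a = a' := Fin.ext hij
  rfl

theorem card_diagramBox_col (j : ℕ) :
    Fintype.card {b : DiagramBox l // (b.2 : ℕ) = j} = colLength l j := by
  rw [colLength, ← Fintype.card_subtype]
  refine Fintype.card_congr ⟨fun b => ⟨b.1.1, b.2.symm.trans_lt b.1.2.2⟩, fun i => ⟨⟨i.1, ⟨j, i.2⟩⟩, rfl⟩, ?_,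
    fun i => rfl⟩
  rintro ⟨⟨i, x⟩, rfl⟩
  rfl

/-- A colouring whose class sizes are, up to order, the column lengths of the diagram comes from
a tableau. -/
theorem exists_tableau_of_truncSum_eq (hanti : Antitone l) (hsum : ∑ i, l i = n)
    (c : Fin n → Fin n) (hc : ∀ t, truncSum (colorCard c) t = rowSum l t) :
    ∃ T : YoungTableau l n, ∀ x y, c x = c y ↔ ((T.symm x).2 : ℕ) = (T.symm y).2 := by
  have hc' : ∀ t, truncSum (colorCard c) t = truncSum (fun j : Fin n => colLength l j) t :=
    fun t => by rw [hc, truncSum_colLength hanti hsum]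
  -- Equal truncated sums force equal multiplicities of every class size. Hence colours can be
  -- matched with columns of the same length, and then boxes with variables column by column.
  have hcard : ∀ s, Fintype.card {j : Fin n // colorCard c j = s} =
      Fintype.card {j : Fin n // colLength l j = s} := by
    intro s
    rw [Fintype.card_subtype, Fintype.card_subtype]
    exact le_antisymm (card_filter_eq_le_of_truncSum_eq (fun t => (hc' t).ge) (hc' s).symm)
      (card_filter_eq_le_of_truncSum_eq (fun t => (hc' t).le) (hc' s))
  let π : Fin n ≃ Fin n := Equiv.ofFiberEquiv (f := colorCard c)
    (g := fun j : Fin n => colLength l j) fun s => Fintype.equivOfCardEq (hcard s)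
  have hπ : ∀ j, colLength l (π j) = colorCard c j := fun j =>
    Equiv.ofFiberEquiv_map (g := fun j : Fin n => colLength l j) _ j
  let col : DiagramBox l → Fin n := fun b => ⟨b.2, b.2.2.trans_le (le_of_sum_eq hsum _)⟩
  have hfib : ∀ j, Fintype.card {b // col b = j} = Fintype.card {x // π (c x) = j} := by
    intro j
    have h1 : Fintype.card {b // col b = j} = colLength l j := by
      rw [← card_diagramBox_col]
      simp [col, Fin.ext_iff]
    rw [h1, ← π.apply_symm_apply j, hπ, colorCard, ← Fintype.card_subtype]
    simp [Equiv.eq_symm_apply]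
  let T : YoungTableau l n := Equiv.ofFiberEquiv (g := fun x => π (c x)) fun j =>
    Fintype.equivOfCardEq (hfib j)
  have hT : ∀ b, π (c (T b)) = col b := fun b =>
    Equiv.ofFiberEquiv_map (g := fun x => π (c x)) _ b
  refine ⟨T, fun x y => ?_⟩
  have h1 := hT (T.symm x)
  have h2 := hT (T.symm y)
  rw [Equiv.apply_symm_apply] at h1 h2
  rw [← π.injective.eq_iff, h1, h2, Fin.ext_iff]

theorem colorPoly_mem_spechtIdeal (K : Type*) [Field K] (hanti : Antitone l)
    (hsum : ∑ i, l i = n) {c : Fin n → Fin n} (hc : IsDominated l c) {ρ : Fin n → ℕ}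
    (hρ : Function.Injective ρ) : colorPoly K c ρ ∈ spechtIdeal K l n := by
  have hq := truncSum_colLength hanti hsum
  refine colorPoly_mem_of_truncSum_le _ hρ (fun j : Fin n => colLength l j) ?_ (fun c hc => ?_) c
    (fun t => (hc t).trans_eq (hq t).symm)
  · rw [← truncSum_eq_sum _ (t := m), hq, rowSum_of_le hsum le_rfl, Fintype.card_fin]
    exact fun j => (Finset.card_le_univ _).trans (by simp)
  · obtain ⟨T, hT⟩ := exists_tableau_of_truncSum_eq hanti hsum c fun t => by rw [hc, hq]
    obtain ⟨u, hu⟩ := spechtPolynomial_associated K T hT hρ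
    rw [← hu]
    exact Ideal.mul_mem_right _ _ (Ideal.subset_span ⟨T, rfl⟩)

end Specht

/-! ### Words and the columns formed by repeated letters -/

/-- The number of positions before `t` at which the word `A` has the letter `w`. -/
def occ {V : Type*} [DecidableEq V] (A : ℕ → V) (t : ℕ) (w : V) : ℕ :=
  ((Finset.range t).filter fun s => A s = w).card

section Words

variable {V : Type*} [DecidableEq V]

theorem occ_zero (A : ℕ → V) (w : V) : occ A 0 w = 0 := by simp [occ]

theorem occ_succ (A : ℕ → V) (t : ℕ) (w : V) :
    occ A (t + 1) w = occ A t w + if A t = w then 1 else 0 := by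
  rw [occ, Finset.range_add_one, Finset.filter_insert]
  split_ifs with h
  · rw [Finset.card_insert_of_notMem (by simp)]
    rfl
  · rfl

theorem occ_le (A : ℕ → V) (t : ℕ) (w : V) : occ A t w ≤ t :=
  (Finset.card_filter_le _ _).trans (by simp)

theorem occ_mono (A : ℕ → V) (w : V) : Monotone fun t => occ A t w :=
  monotone_nat_of_le_succ fun t => by simp [occ_succ]

theorem occ_congr {A B : ℕ → V} {t : ℕ} (h : ∀ s < t, A s = B s) (w : V) :
    occ A t w = occ B t w := by
  unfold occ
  congr 1
  refine Finset.filter_congr fun s hs => ?_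
  rw [h s (Finset.mem_range.1 hs)]

theorem occ_lt_occ (A : ℕ → V) {s t : ℕ} (h : s < t) : occ A s (A s) < occ A t (A s) := by
  refine lt_of_lt_of_le ?_ (occ_mono A (A s) h)
  simp [occ_succ]

theorem exists_occ_eq (A : ℕ → V) {t k : ℕ} {w : V} (h : k < occ A t w) :
    ∃ s < t, A s = w ∧ occ A s w = k := by
  induction t with
  | zero => simp [occ_zero] at h
  | succ t ih =>
    rcases lt_or_ge k (occ A t w) with h1 | h1
    · obtain ⟨s, hs, h2⟩ := ih h1
      exact ⟨s, by omega, h2⟩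
    · rw [occ_succ] at h
      split_ifs at h with h2
      · exact ⟨t, by omega, h2, by omega⟩
      · omega

/-- If every position is put into the column given by the number of earlier occurrences of its
letter, then its height in this column is the number of letters with more earlier occurrences. -/
theorem card_filter_occ_eq (A : ℕ → V) (t : ℕ) :
    ((Finset.range t).filter fun s => occ A s (A s) = occ A t (A t)).card =
      (((Finset.range t).image A).filter fun w => occ A t (A t) < occ A t w).card := by
  refine Finset.card_bij (fun s _ => A s) ?_ ?_ ?_
  · intro s hs
    simp only [Finset.mem_filter, Finset.mem_range] at hs
    simp only [Finset.mem_filter, Finset.mem_image, Finset.mem_range]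
    refine ⟨⟨s, hs.1, rfl⟩, ?_⟩
    rw [← hs.2]
    exact occ_lt_occ A hs.1
  · intro s hs s' hs' h
    simp only [Finset.mem_filter, Finset.mem_range] at hs hs'
    rcases lt_trichotomy s s' with h1 | h1 | h1
    · have := occ_lt_occ A h1
      rw [hs.2, h, hs'.2] at this
      omega
    · exact h1
    · have := occ_lt_occ A h1
      rw [hs'.2, ← h, hs.2] at this
      omega
  · intro w hw
    simp only [Finset.mem_filter] at hw
    obtain ⟨s, hs, rfl, h2⟩ := exists_occ_eq A hw.2
    exact ⟨s, by simp [hs, h2], rfl⟩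

end Words

/-! ### Heights in colour classes -/

section Height

/-- The height of `i` in its colour class: the number of elements of this class of smaller
rank. -/
def height {ι γ : Type*} [Fintype ι] [DecidableEq γ] (c : ι → γ) (ρ : ι → ℕ) (i : ι) : ℕ :=
  (Finset.univ.filter fun j => c j = c i ∧ ρ j < ρ i).card

/-- Counting smaller elements numbers the elements of `S` bijectively by 0, …, |S| - 1. -/
theorem card_filter_rank_lt {ι : Type*} (S : Finset ι) {ρ : ι → ℕ} (hρ : Set.InjOn ρ S) (t : ℕ) :
    (S.filter fun i => (S.filter fun j => ρ j < ρ i).card < t).card = min S.card t := by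
  set rk : ι → ℕ := fun i => (S.filter fun j => ρ j < ρ i).card with hrk
  have hlt : ∀ i ∈ S, ∀ j ∈ S, ρ i < ρ j → rk i < rk j := by
    intro i hi j hj hij
    refine Finset.card_lt_card ⟨fun x hx => ?_, fun hx => ?_⟩
    · rw [Finset.mem_filter] at hx ⊢
      exact ⟨hx.1, hx.2.trans hij⟩
    · simpa using (Finset.mem_filter.1 (hx (Finset.mem_filter.2 ⟨hi, hij⟩))).2
  have hinj : Set.InjOn rk S := by
    intro i hi j hj hij
    rcases lt_trichotomy (ρ i) (ρ j) with h | h | h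
    · exact absurd hij (hlt i hi j hj h).ne
    · exact hρ hi hj h
    · exact absurd hij (hlt j hj i hi h).ne'
  have himg : S.image rk = Finset.range S.card := by
    refine Finset.eq_of_subset_of_card_le (fun x hx => ?_) ?_
    · obtain ⟨i, hi, rfl⟩ := Finset.mem_image.1 hx
      rw [Finset.mem_range]
      exact Finset.card_lt_card (Finset.filter_ssubset.2 ⟨i, hi, lt_irrefl _⟩)
    · rw [Finset.card_image_of_injOn hinj, Finset.card_range]
  have : (S.filter fun i => rk i < t).image rk = Finset.range (min S.card t) := by
    ext x
    rw [Finset.mem_range, lt_min_iff, ← Finset.mem_range, ← himg]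
    simp only [Finset.mem_image, Finset.mem_filter]
    constructor
    · rintro ⟨i, ⟨hi, h⟩, rfl⟩
      exact ⟨⟨i, hi, rfl⟩, h⟩
    · rintro ⟨⟨i, hi, rfl⟩, h⟩
      exact ⟨i, ⟨hi, h⟩, rfl⟩
  rw [← Finset.card_image_of_injOn
    (hinj.mono (Finset.coe_subset.2 (Finset.filter_subset (fun i => rk i < t) S))), this,
    Finset.card_range]

/-- A class of size s has one element of each height 0, …, s - 1, hence min(s, t) elements of height
below t. -/
theorem truncSum_colorCard_eq {ι γ : Type*} [Fintype ι] [Fintype γ] [DecidableEq γ] (c : ι → γ)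
    {ρ : ι → ℕ} (hρ : ∀ i j, c i = c j → ρ i = ρ j → i = j) (t : ℕ) :
    truncSum (colorCard c) t = (Finset.univ.filter fun i => height c ρ i < t).card := by
  rw [Finset.card_eq_sum_card_fiberwise (f := c) (t := Finset.univ) (by simp)]
  refine Finset.sum_congr rfl fun j _ => ?_
  rw [colorCard, ← card_filter_rank_lt (ρ := ρ)]
  · congr 1
    ext i
    rw [Finset.mem_filter, Finset.mem_filter, Finset.mem_filter, Finset.mem_filter]
    constructor
    · rintro ⟨⟨_, rfl⟩, h⟩
      exact ⟨⟨Finset.mem_univ _, by simpa only [height, Finset.filter_filter] using h⟩, rfl⟩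
    · rintro ⟨⟨_, h⟩, rfl⟩
      exact ⟨⟨Finset.mem_univ _, rfl⟩, by simpa only [height, Finset.filter_filter] using h⟩
  · intro i hi i' hi' h
    simp only [Finset.coe_filter, Finset.mem_univ, true_and, Set.mem_ofPred_eq] at hi hi'
    exact hρ i i' (by rw [hi, hi']) h

/-- The colouring of `Fin n` by columns attached to a word, whose positions are assigned to the
elements of `Fin n` by `σ`. -/
def wordColoring {n : ℕ} {V : Type*} [DecidableEq V] (σ : Equiv.Perm (Fin n)) (A : ℕ → V)
    (i : Fin n) : Fin n :=
  ⟨occ A (σ.symm i) (A (σ.symm i)), (occ_le _ _ _).trans_lt (σ.symm i).2⟩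

theorem height_wordColoring {n : ℕ} {V : Type*} [DecidableEq V] (σ : Equiv.Perm (Fin n))
    (A : ℕ → V) (i : Fin n) :
    height (wordColoring σ A) (fun j => σ.symm j) i =
      (((Finset.range (σ.symm i)).image A).filter fun w =>
        occ A (σ.symm i) (A (σ.symm i)) < occ A (σ.symm i) w).card := by
  rw [← card_filter_occ_eq, height]
  refine Finset.card_bij (fun j _ => (σ.symm j : ℕ)) ?_ ?_ ?_
  · intro j hj
    simpa [wordColoring, and_comm] using hj
  · intro j _ j' _ h
    exact σ.symm.injective (Fin.ext h)
  · intro s hs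
    simp only [Finset.mem_filter, Finset.mem_range] at hs
    have hn := hs.1.trans (σ.symm i).2
    refine ⟨σ ⟨s, hn⟩, ?_, by simp⟩
    simp only [Finset.mem_filter, Finset.mem_univ, true_and, wordColoring, Fin.mk.injEq,
      Equiv.symm_apply_apply]
    exact ⟨hs.2, hs.1⟩

end Height

/-! ### Nonvanishing points and lexicographic leading exponents -/

section Points

variable {K L : Type*} [Field K] [Field L] [Algebra K L] {n : ℕ}

theorem le_degree_lexOrderOfPerm (σ : Equiv.Perm (Fin n)) {f : MvPolynomial (Fin n) K}
    {u : Fin n →₀ ℕ} (hu : u ∈ f.support) (s : Fin n)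
    (h : ∀ j, s < j → u (σ j) = (lexOrderOfPerm σ).degree f (σ j)) :
    u (σ s) ≤ (lexOrderOfPerm σ).degree f (σ s) := by
  by_contra hlt
  have h1 := (lexOrderOfPerm σ).le_degree hu
  exact h1.not_gt ((lexOrderOfPerm_lt_iff σ _ _).2 ⟨s, fun j hj => (h j hj).symm, not_le.1 hlt⟩)

/-- The coefficient, evaluated at `A`, of the part of `x^e` in the variables at positions at
least `s`. -/
noncomputable def partialEval (L : Type*) [Field L] [Algebra K L] (σ : Equiv.Perm (Fin n))
    (f : MvPolynomial (Fin n) K) (e : Fin n →₀ ℕ) (s : ℕ) (A : ℕ → L) : L :=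
  ∑ u ∈ f.support with ∀ j : Fin n, s ≤ j → u (σ j) = e (σ j),
    algebraMap K L (f.coeff u) * ∏ j : Fin n with j.val < s, A j ^ u (σ j)

-- This links consecutive stages of `partialEval`: with the coordinates before s fixed, a univariate
-- polynomial of degree at most the leading exponent has the stage-s value as its coefficient in
-- that degree and the stage-(s + 1) values as its values. A nonzero stage s thus excludes only that
-- many choices of the next coordinate.
open Polynomial in
theorem exists_polynomial_partialEval (σ : Equiv.Perm (Fin n)) {f : MvPolynomial (Fin n) K}
    (A : ℕ → L) {s : ℕ} (hs : s < n) :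
    ∃ Q : L[X], Q.natDegree ≤ (lexOrderOfPerm σ).degree f (σ ⟨s, hs⟩) ∧
      Q.coeff ((lexOrderOfPerm σ).degree f (σ ⟨s, hs⟩)) =
        partialEval L σ f ((lexOrderOfPerm σ).degree f) s A ∧
      ∀ x, Q.eval x = partialEval L σ f ((lexOrderOfPerm σ).degree f) (s + 1)
        (Function.update A s x) := by
  set e := (lexOrderOfPerm σ).degree f with he
  refine ⟨∑ u ∈ f.support with ∀ j : Fin n, s + 1 ≤ j → u (σ j) = e (σ j),
    C (algebraMap K L (f.coeff u) * ∏ j : Fin n with j.val < s, A j ^ u (σ j)) *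
      X ^ u (σ ⟨s, hs⟩), ?_, ?_, fun x => ?_⟩
  · refine natDegree_sum_le_of_forall_le _ _ fun u hu => (natDegree_C_mul_X_pow_le _ _).trans ?_
    rw [Finset.mem_filter] at hu
    exact le_degree_lexOrderOfPerm σ hu.1 _ fun j hj => hu.2 j hj
  · simp only [finsetSum_coeff, coeff_C_mul, coeff_X_pow, mul_ite, mul_one, mul_zero]
    rw [← Finset.sum_filter, Finset.filter_filter, partialEval]
    refine Finset.sum_congr (Finset.filter_congr fun u _ => ?_) fun _ _ => rfl
    constructor
    · rintro ⟨h1, h2⟩ j hj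
      rcases hj.eq_or_lt with h3 | h3
      · obtain rfl : j = ⟨s, hs⟩ := Fin.ext h3.symm
        exact h2.symm
      · exact h1 j h3
    · exact fun h => ⟨fun j hj => h j (by omega), (h ⟨s, hs⟩ le_rfl).symm⟩
  · rw [eval_finsetSum, partialEval]
    refine Finset.sum_congr rfl fun u _ => ?_
    have hf : (Finset.univ.filter fun j : Fin n => j.val < s + 1) =
        insert ⟨s, hs⟩ (Finset.univ.filter fun j : Fin n => j.val < s) := by
      ext j
      simp only [Finset.mem_filter, Finset.mem_univ, true_and, Finset.mem_insert, Fin.ext_iff]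
      omega
    rw [hf, Finset.prod_insert (by simp), eval_mul, eval_C, eval_pow, eval_X,
      Function.update_self]
    have : ∏ j : Fin n with j.val < s, Function.update A s x j ^ u (σ j) =
        ∏ j : Fin n with j.val < s, A j ^ u (σ j) := by
      refine Finset.prod_congr rfl fun j hj => ?_
      simp only [Finset.mem_filter, Finset.mem_univ, true_and] at hj
      rw [Function.update_of_ne hj.ne]
    rw [this]
    ring

theorem partialEval_zero (σ : Equiv.Perm (Fin n)) {f : MvPolynomial (Fin n) K} {e : Fin n →₀ ℕ}
    (he : e ∈ f.support) (A : ℕ → L) :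
    partialEval L σ f e 0 A = algebraMap K L (f.coeff e) := by
  have : (f.support.filter fun u => ∀ j : Fin n, 0 ≤ j.val → u (σ j) = e (σ j)) = {e} := by
    ext u
    simp only [Finset.mem_filter, Finset.mem_singleton, zero_le, true_implies]
    constructor
    · rintro ⟨_, h⟩
      ext i
      simpa using h (σ.symm i)
    · rintro rfl
      exact ⟨he, fun _ => rfl⟩
  rw [partialEval, this]
  simp

theorem partialEval_self (σ : Equiv.Perm (Fin n)) (f : MvPolynomial (Fin n) K) (e : Fin n →₀ ℕ)
    (A : ℕ → L) :
    partialEval L σ f e n A = MvPolynomial.aeval (fun i => A (σ.symm i)) f := by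
  rw [partialEval, Finset.filter_true_of_mem fun u _ j hj => absurd j.2 hj.not_gt,
    MvPolynomial.aeval_def, MvPolynomial.eval₂_eq']
  refine Finset.sum_congr rfl fun u _ => ?_
  rw [Finset.filter_true_of_mem fun j _ => j.2]
  congr 1
  exact Fintype.prod_equiv σ _ _ fun j => by simp

/-- A polynomial with lexicographic degree `e` has a nonzero at a point which repeats earlier
coordinates as often as `e` permits. -/
theorem exists_aeval_ne_zero [Infinite L] [DecidableEq L] (σ : Equiv.Perm (Fin n))
    {f : MvPolynomial (Fin n) K} (hf : f ≠ 0) :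
    ∃ A : ℕ → L, MvPolynomial.aeval (fun i => A (σ.symm i)) f ≠ 0 ∧
      ∀ i, height (wordColoring σ A) (fun j => σ.symm j) i ≤
        (lexOrderOfPerm σ).degree f i := by
  set e := (lexOrderOfPerm σ).degree f with he
  suffices h : ∀ s ≤ n, ∃ A : ℕ → L, partialEval L σ f e s A ≠ 0 ∧ ∀ t : Fin n, t.val < s →
      (((Finset.range t).image A).filter fun w => occ A t (A t) < occ A t w).card ≤ e (σ t) by
    obtain ⟨A, h1, h2⟩ := h n le_rfl
    refine ⟨A, by rwa [← partialEval_self σ f e], fun i => ?_⟩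
    rw [height_wordColoring]
    simpa using h2 (σ.symm i) (σ.symm i).2
  intro s hs
  induction s with
  | zero =>
    refine ⟨fun _ => 0, ?_, fun t ht => absurd ht (Nat.not_lt_zero _)⟩
    rw [partialEval_zero σ ((lexOrderOfPerm σ).degree_mem_support hf)]
    simpa using hf
  | succ s ih =>
    obtain ⟨A, h1, h2⟩ := ih (by omega)
    obtain ⟨Q, hQd, hQc, hQe⟩ := exists_polynomial_partialEval (L := L) σ (f := f) A hs
    rw [← he] at hQd hQc hQe
    have hQ : Q ≠ 0 := by
      rintro rfl
      exact h1 (by simpa using hQc.symm)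
    have hne : {x | Q.eval x ≠ 0}.Nonempty := by
      obtain ⟨x, hx⟩ := Infinite.exists_notMem_finset Q.roots.toFinset
      exact ⟨x, fun h => hx (by simp [hQ, h])⟩
    -- Among the non-roots of Q, take x with the most earlier occurrences. Every value that occurred
    -- more often is then a root of Q, and Q has at most as many roots as the exponent at this
    -- position.
    obtain ⟨x, hx, hmin⟩ := (measure fun x => s - occ A s x).wf.has_min _ hne
    refine ⟨Function.update A s x, by rw [← hQe]; exact hx, fun t ht => ?_⟩
    have hcongr : ∀ r < t.val, Function.update A s x r = A r := fun r hr =>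
      Function.update_of_ne (by omega) _ _
    have himg : (Finset.range t).image (Function.update A s x) = (Finset.range t).image A :=
      Finset.image_congr fun r hr => hcongr r (by simpa using hr)
    simp only [himg, occ_congr hcongr]
    rcases (Nat.lt_succ_iff.1 ht).eq_or_lt with hts | hts
    · obtain rfl : t = ⟨s, hs⟩ := Fin.ext hts
      simp only [Function.update_self]
      refine le_trans ?_ ((Polynomial.card_roots' Q).trans hQd)
      refine le_trans (Finset.card_le_card fun w hw => ?_) (Multiset.toFinset_card_le _)
      rw [Finset.mem_filter] at hw
      rw [Multiset.mem_toFinset, Polynomial.mem_roots hQ, Polynomial.IsRoot.def]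
      by_contra hw'
      have h3 : ¬ s - occ A s w < s - occ A s x := hmin w hw'
      have := occ_le A s w
      have := hw.2
      omega
    · rw [Function.update_of_ne hts.ne]
      exact h2 t hts

end Points

/-! ### Colourings from nonvanishing points are dominated -/

section Dominance

variable {n : ℕ}

theorem card_filter_mem_eq_sum_colorCard {γ : Type*} [DecidableEq γ] (d : Fin n → γ)
    (J : Finset γ) :
    (Finset.univ.filter fun i => d i ∈ J).card = ∑ j ∈ J, colorCard d j := by
  rw [Finset.card_eq_sum_card_fiberwise (f := d) (t := J) (by intro i; simp)]
  refine Finset.sum_congr rfl fun j hj => ?_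
  rw [colorCard]
  congr 1
  ext i
  simp only [Finset.mem_filter, Finset.mem_univ, true_and, and_iff_right_iff_imp]
  rintro rfl
  exact hj

/-- If any `r` classes of `d` together have at most as many elements as the first `r` classes
of `c`, then the truncated sums of the class sizes of `c` are at most those of `d`. -/
theorem truncSum_colorCard_le (c d : Fin n → Fin n)
    (h : ∀ J : Finset (Fin n), (Finset.univ.filter fun i => d i ∈ J).card ≤
      (Finset.univ.filter fun i => (c i).val < J.card).card) (t : ℕ) :
    truncSum (colorCard c) t ≤ truncSum (colorCard d) t := by
  -- For this J, the sum of the min(d_j, t) plus the total size of the classes in J equals n + |J|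
  -- t. For `c` with any |J| classes in place of J, the same expression is at most n + |J| t.
  set J := Finset.univ.filter fun j => t < colorCard d j with hJ
  have hX := h J
  rw [card_filter_mem_eq_sum_colorCard] at hX
  have hY : (Finset.univ.filter fun i => (c i).val < J.card).card =
      ∑ j : Fin n, if j.val < J.card then colorCard c j else 0 := by
    rw [← Finset.sum_filter, ← card_filter_mem_eq_sum_colorCard]
    simp
  have hc := sum_colorCard c
  have hd := sum_colorCard d
  have h1 : truncSum (colorCard d) t + ∑ j ∈ J, colorCard d j =
      ∑ j, colorCard d j + J.card * t := by
    rw [← smul_eq_mul, ← Finset.sum_const, hJ, Finset.sum_filter, Finset.sum_filter, truncSum,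
      ← Finset.sum_add_distrib, ← Finset.sum_add_distrib]
    refine Finset.sum_congr rfl fun j _ => ?_
    split_ifs <;> omega
  have h2 : truncSum (colorCard c) t + ∑ j : Fin n, (if j.val < J.card then colorCard c j else 0) ≤
      ∑ j, colorCard c j + J.card * t := by
    have hJn : J.card ≤ n := (Finset.card_le_univ J).trans (by simp)
    have h3 : J.card * t = ∑ j : Fin n, if j.val < J.card then t else 0 := by
      rw [← Finset.sum_filter, Finset.sum_const, Fin.card_filter_val_lt, min_eq_right hJn,
        smul_eq_mul]
    rw [h3, truncSum, ← Finset.sum_add_distrib, ← Finset.sum_add_distrib]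
    refine Finset.sum_le_sum fun j _ => ?_
    split_ifs <;> omega
  omega

theorem occ_eq_card {V : Type*} [DecidableEq V] (σ : Equiv.Perm (Fin n)) (A : ℕ → V) (i : Fin n)
    (w : V) : occ A (σ.symm i) w =
      ((Finset.univ.filter fun j => A (σ.symm j) = w).filter
        fun j => (σ.symm j : ℕ) < σ.symm i).card := by
  symm
  rw [occ]
  refine Finset.card_bij (fun j _ => (σ.symm j : ℕ)) ?_ ?_ ?_
  · intro j hj
    simpa [and_comm] using hj
  · intro j _ j' _ h
    exact σ.symm.injective (Fin.ext h)
  · intro s hs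
    simp only [Finset.mem_filter, Finset.mem_range] at hs
    refine ⟨σ ⟨s, hs.1.trans (σ.symm i).2⟩, ?_, by simp⟩
    simp only [Finset.mem_filter, Finset.mem_univ, true_and, Equiv.symm_apply_apply]
    exact ⟨hs.2, hs.1⟩

/-- This holds letter by letter. `d` is injective on the positions of a letter, so at most
min(multiplicity, |J|) of them land in J; `wordColoring` numbers these positions 0, 1, 2, … and
attains this bound with its first |J| colours. -/
theorem card_filter_mem_le_wordColoring {V : Type*} [DecidableEq V] (σ : Equiv.Perm (Fin n))
    (A : ℕ → V) (d : Fin n → Fin n)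
    (hd : ∀ x y, A (σ.symm x) = A (σ.symm y) → d x = d y → x = y) (J : Finset (Fin n)) :
    (Finset.univ.filter fun i => d i ∈ J).card ≤
      (Finset.univ.filter fun i => (wordColoring σ A i).val < J.card).card := by
  set a : Fin n → V := fun i => A (σ.symm i) with ha
  rw [Finset.card_eq_sum_card_fiberwise (f := a) (t := Finset.univ.image a) (by simp [Set.MapsTo]),
    Finset.card_eq_sum_card_fiberwise (f := a) (t := Finset.univ.image a)
      (s := Finset.univ.filter fun i => (wordColoring σ A i).val < J.card) (by simp [Set.MapsTo])]
  refine Finset.sum_le_sum fun w _ => ?_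
  have h1 : ((Finset.univ.filter fun i => d i ∈ J).filter fun i => a i = w).card ≤
      min (Finset.univ.filter fun i => a i = w).card J.card := by
    refine le_min (Finset.card_le_card fun i => by simp) ?_
    refine Finset.card_le_card_of_injOn d (by intro i; simp; tauto) ?_
    intro x hx y hy hxy
    simp only [Finset.coe_filter, Finset.mem_filter, Finset.mem_univ, true_and,
      Set.mem_ofPred_eq] at hx hy
    exact hd x y (hx.2.trans hy.2.symm) hxy
  refine h1.trans ?_
  rw [← card_filter_rank_lt (ρ := fun j => (σ.symm j : ℕ))]
  · refine Finset.card_le_card fun i hi => ?_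
    simp only [Finset.mem_filter, Finset.mem_univ, true_and] at hi ⊢
    refine ⟨?_, hi.1⟩
    rw [wordColoring]
    simp only
    rw [occ_eq_card]
    rw [← hi.1] at hi
    exact hi.2
  · intro x _ y _ h
    exact σ.symm.injective (Fin.ext h)

variable {m : ℕ} {l : Fin m → ℕ}

/-- If f_T is nonzero at the point, the entries of each column of T have distinct values. The
columns of T therefore satisfy the hypothesis on `d` in `card_filter_mem_le_wordColoring`, and their
sizes are the column lengths of λ. -/
theorem isDominated_wordColoring {K L : Type*} [Field K] [Field L] [Algebra K L] [DecidableEq L]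
    (hanti : Antitone l) (hsum : ∑ i, l i = n) (T : YoungTableau l n) (σ : Equiv.Perm (Fin n))
    (A : ℕ → L)
    (h : MvPolynomial.aeval (fun i => A (σ.symm i)) (spechtPolynomial K T) ≠ 0) :
    IsDominated l (wordColoring σ A) := by
  let d : Fin n → Fin n := fun x => ⟨(T.symm x).2, (T.symm x).2.2.trans_le (le_of_sum_eq hsum _)⟩
  have hcd : colorCard d = fun j : Fin n => colLength l j := by
    funext j
    rw [← card_diagramBox_col, colorCard, ← Fintype.card_subtype]
    exact Fintype.card_congr (T.symm.subtypeEquiv fun x => by simp [d, Fin.ext_iff])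
  have hd : ∀ x y, A (σ.symm x) = A (σ.symm y) → d x = d y → x = y := by
    intro x y hxy hdxy
    by_contra hne
    have hdxy' : ((T.symm x).2 : ℕ) = (T.symm y).2 := congrArg Fin.val hdxy
    have hrow : (T.symm x).1 ≠ (T.symm y).1 := by
      intro e
      apply hne
      apply T.symm.injective
      rcases hi : T.symm x with ⟨r, a⟩
      rcases hj : T.symm y with ⟨r', a'⟩
      rw [hi, hj] at hdxy' e
      dsimp only at e
      subst e
      obtain rfl : a = a' := Fin.ext hdxy'
      rfl
    apply h
    rw [spechtPolynomial, map_prod]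
    rcases lt_or_gt_of_ne hrow with hlt | hlt
    · refine Finset.prod_eq_zero (i := (T.symm x, T.symm y)) ?_ ?_
      · simp [hlt, hdxy']
      · simp [hxy]
    · refine Finset.prod_eq_zero (i := (T.symm y, T.symm x)) ?_ ?_
      · simp [hlt, hdxy']
      · simp [hxy]
  intro t
  rw [← truncSum_colLength hanti hsum, ← hcd]
  exact truncSum_colorCard_le _ _ (card_filter_mem_le_wordColoring σ A d hd) t

/-- The leading monomial of an element of the Specht ideal is divisible by the leading monomial of
a Specht polynomial of dominated shape. -/
theorem exists_isDominated_height_le {K : Type*} [Field K] (hanti : Antitone l)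
    (hsum : ∑ i, l i = n) (σ : Equiv.Perm (Fin n)) {f : MvPolynomial (Fin n) K} (hf : f ≠ 0)
    (hfI : f ∈ spechtIdeal K l n) :
    ∃ c : Fin n → Fin n, IsDominated l c ∧
      ∀ i, height c (fun j => σ.symm j) i ≤ (lexOrderOfPerm σ).degree f i := by
  classical
  -- `K` may be finite, so the point is taken over its algebraic closure, which always has values
  -- outside a finite set of roots.
  obtain ⟨A, hA, hh⟩ := exists_aeval_ne_zero (L := AlgebraicClosure K) σ hf
  obtain ⟨T, hT⟩ : ∃ T : YoungTableau l n,
      MvPolynomial.aeval (fun i => A (σ.symm i)) (spechtPolynomial K T) ≠ 0 := by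
    by_contra hall
    push Not at hall
    apply hA
    have : spechtIdeal K l n ≤ RingHom.ker (MvPolynomial.aeval (R := K) fun i => A (σ.symm i)) := by
      rw [spechtIdeal, Ideal.span_le]
      rintro _ ⟨T, rfl⟩
      exact hall T
    exact this hfI
  exact ⟨_, isDominated_wordColoring hanti hsum T σ A hT, hh⟩

end Dominance

/-! ### Initial ideals and their dependence on the order of the variables -/

section InitialIdeal

open MvPolynomial

variable {n : ℕ} {K : Type*} [Field K]

/-- The exponents of the leading monomials of the nonzero elements of `I`. -/
def leadingExponents (M : MonomialOrder (Fin n)) (I : Ideal (MvPolynomial (Fin n) K)) :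
    Set (Fin n →₀ ℕ) :=
  {e | ∃ f ∈ I, f ≠ 0 ∧ M.degree f = e}

theorem mem_leadingExponents_of_le {M : MonomialOrder (Fin n)} {I : Ideal (MvPolynomial (Fin n) K)}
    {e e' : Fin n →₀ ℕ} (he : e ∈ leadingExponents M I) (h : e ≤ e') :
    e' ∈ leadingExponents M I := by
  obtain ⟨f, hfI, hf, rfl⟩ := he
  have h1 : (monomial (e' - M.degree f) (1 : K)) ≠ 0 := by simp
  refine ⟨monomial (e' - M.degree f) 1 * f, I.mul_mem_left _ hfI, mul_ne_zero h1 hf, ?_⟩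
  classical
  rw [M.degree_mul h1 hf, M.degree_monomial, if_neg one_ne_zero, tsub_add_cancel_of_le h]

theorem initialIdeal_eq_span (M : MonomialOrder (Fin n)) (I : Ideal (MvPolynomial (Fin n) K)) :
    initialIdeal M I = Ideal.span ((fun e => monomial e (1 : K)) '' leadingExponents M I) := by
  rw [initialIdeal, M.span_leadingTerm_eq_span_monomial']
  congr 1
  ext x
  simp only [Set.mem_image, leadingExponents, Set.mem_ofPred_eq, Set.mem_sdiff,
    Set.mem_singleton_iff, SetLike.mem_coe]
  constructor
  · rintro ⟨f, ⟨h1, h2⟩, rfl⟩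
    exact ⟨_, ⟨f, h1, h2, rfl⟩, rfl⟩
  · rintro ⟨_, ⟨f, h1, h2, rfl⟩, rfl⟩
    exact ⟨f, ⟨h1, h2⟩, rfl⟩

theorem monomial_mem_initialIdeal_iff {M : MonomialOrder (Fin n)}
    {I : Ideal (MvPolynomial (Fin n) K)} {e : Fin n →₀ ℕ} :
    monomial e (1 : K) ∈ initialIdeal M I ↔ e ∈ leadingExponents M I := by
  rw [initialIdeal_eq_span, mem_ideal_span_monomial_image]
  classical
  rw [support_monomial, if_neg one_ne_zero]
  simp only [Finset.mem_singleton, forall_eq]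
  constructor
  · rintro ⟨e', he', h⟩
    exact mem_leadingExponents_of_le he' h
  · exact fun h => ⟨e, h, le_rfl⟩

theorem initialIdeal_eq_iff {M M' : MonomialOrder (Fin n)} {I : Ideal (MvPolynomial (Fin n) K)} :
    initialIdeal M I = initialIdeal M' I ↔ leadingExponents M I = leadingExponents M' I := by
  constructor
  · intro h
    ext e
    rw [← monomial_mem_initialIdeal_iff, h, monomial_mem_initialIdeal_iff]
  · intro h
    rw [initialIdeal_eq_span, initialIdeal_eq_span, h]

/-- Two sets of leading exponents of the same ideal are equal as soon as one contains the other. -/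
theorem leadingExponents_eq_of_subset {M M' : MonomialOrder (Fin n)}
    {I : Ideal (MvPolynomial (Fin n) K)} (h : leadingExponents M I ⊆ leadingExponents M' I) :
    leadingExponents M I = leadingExponents M' I := by
  classical
  refine h.antisymm fun e he => ?_
  by_contra hne
  -- Divide x^e by all nonzero elements of `I` with respect to M'. The remainder r has no exponent
  -- in the leading exponents for M', so x^e - r is a nonzero element of `I`. Its leading exponent
  -- for M is not e, hence is an exponent of r, although the assumed inclusion makes it a leading
  -- exponent for M'.
  obtain ⟨g, r, hgr, -, hr⟩ := M'.div_set (B := (I : Set _) \ {0})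
    (fun b hb => isUnit_iff_ne_zero.2 (M'.leadingCoeff_ne_zero_iff.2 hb.2)) (monomial e (1 : K))
  have hr' : ∀ c ∈ r.support, c ∉ leadingExponents M' I := by
    rintro c hc ⟨f, hfI, hf, rfl⟩
    exact hr _ hc f ⟨hfI, hf⟩ le_rfl
  have hmem : monomial e (1 : K) - r ∈ I := by
    rw [hgr, add_sub_cancel_right, Finsupp.linearCombination_apply]
    exact I.sum_mem fun b _ => I.mul_mem_left _ b.2.1
  have hre : coeff e r = 0 := by
    by_contra h0
    exact hr' e (mem_support_iff.2 h0) he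
  have hne0 : monomial e (1 : K) - r ≠ 0 := by
    intro h0
    have := congrArg (coeff e) h0
    simp [hre] at this
  have hdeg : M.degree (monomial e (1 : K) - r) ∈ leadingExponents M I := ⟨_, hmem, hne0, rfl⟩
  have hsupp := M.degree_mem_support hne0
  by_cases hd : M.degree (monomial e (1 : K) - r) = e
  · exact hne (hd ▸ hdeg)
  · refine hr' _ ?_ (h hdeg)
    rw [mem_support_iff, coeff_sub, coeff_monomial, if_neg (Ne.symm hd), zero_sub, neg_ne_zero]
      at hsupp
    exact mem_support_iff.2 hsupp

/-- The variables are ordered by `M` as `x_{σ 0} ≺ x_{σ 1} ≺ ⋯`. -/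
def SortsVariables (M : MonomialOrder (Fin n)) (σ : Equiv.Perm (Fin n)) : Prop :=
  ∀ i j : Fin n, i < j →
    M.toSyn (Finsupp.single (σ i) 1) < M.toSyn (Finsupp.single (σ j) 1)

theorem sortsVariables_lexOrderOfPerm (σ : Equiv.Perm (Fin n)) :
    SortsVariables (lexOrderOfPerm σ) σ := by
  intro i j hij
  rw [lexOrderOfPerm_lt_iff]
  refine ⟨j, fun r hr => ?_, ?_⟩
  · rw [Finsupp.single_eq_of_ne, Finsupp.single_eq_of_ne]
    · exact fun h => hr.ne' (σ.injective h)
    · exact fun h => (hij.trans hr).ne' (σ.injective h)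
  · rw [Finsupp.single_eq_of_ne fun h => hij.ne' (σ.injective h)]
    simp

theorem exists_sortsVariables (M : MonomialOrder (Fin n)) :
    ∃ σ : Equiv.Perm (Fin n), SortsVariables M σ := by
  let f : Fin n → M.syn := fun i => M.toSyn (Finsupp.single i 1)
  have hf : Function.Injective f := fun i j h =>
    (Finsupp.single_left_inj one_ne_zero).1 (M.toSyn.injective h)
  refine ⟨Tuple.sort f, ?_⟩
  exact (Tuple.monotone_sort f).strictMono_of_injective (hf.comp (Tuple.sort f).injective)

/-- Each factor x_a - x_b has the variable of larger rank as its leading monomial, and i is the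
larger one in exactly `height` many factors. Only the order of the variables matters. -/
theorem degree_colorPoly {M : MonomialOrder (Fin n)} {σ : Equiv.Perm (Fin n)}
    (hM : SortsVariables M σ) {γ : Type*} [DecidableEq γ] (c : Fin n → γ) (i : Fin n) :
    M.degree (colorPoly K c fun j => σ.symm j) i = height c (fun j => σ.symm j) i := by
  have hdeg : ∀ a b : Fin n, (σ.symm a : ℕ) < σ.symm b →
      M.degree (X a - X b : MvPolynomial (Fin n) K) = Finsupp.single b 1 := by
    intro a b hab
    have h1 := hM _ _ (Fin.lt_def.2 hab)
    rw [Equiv.apply_symm_apply, Equiv.apply_symm_apply] at h1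
    rw [← neg_sub, M.degree_neg, M.degree_sub_of_lt, M.degree_X]
    rwa [M.degree_X, M.degree_X]
  rw [colorPoly, M.degree_prod, Finset.sum_congr rfl fun p hp =>
    hdeg p.1 p.2 (Finset.mem_filter.1 hp).2.2, Finsupp.finsetSum_apply]
  · simp only [Finsupp.single_apply]
    rw [← Finset.card_filter, Finset.filter_filter, height]
    refine Finset.card_bij (fun p _ => p.1) ?_ ?_ ?_
    · intro p hp
      simp only [Finset.mem_filter, Finset.mem_univ, true_and] at hp ⊢
      rw [← hp.2]
      exact hp.1
    · rintro ⟨a, b⟩ hp ⟨a', b'⟩ hp' h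
      simp only [Finset.mem_filter, Finset.mem_univ, true_and] at hp hp' h
      rw [h, hp.2, hp'.2]
    · intro j hj
      refine ⟨(j, i), by simpa using hj, rfl⟩
  · intro p hp
    refine X_sub_X_ne_zero fun h => ?_
    simp [h] at hp

variable {m : ℕ} {l : Fin m → ℕ}

/-- The combinatorial form of the Gröbner basis property; both directions of the classification of
permutations argue only with this description. -/
theorem mem_leadingExponents_lexOrderOfPerm (hanti : Antitone l) (hsum : ∑ i, l i = n)
    (σ : Equiv.Perm (Fin n)) {e : Fin n →₀ ℕ} :
    e ∈ leadingExponents (lexOrderOfPerm σ) (spechtIdeal K l n) ↔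
      ∃ c : Fin n → Fin n, IsDominated l c ∧ ∀ i, height c (fun j => σ.symm j) i ≤ e i := by
  constructor
  · rintro ⟨f, hfI, hf, rfl⟩
    exact exists_isDominated_height_le hanti hsum σ hf hfI
  · rintro ⟨c, hc, h⟩
    refine mem_leadingExponents_of_le
      ⟨colorPoly K c fun j => σ.symm j, colorPoly_mem_spechtIdeal K hanti hsum hc
        fun i j hij => σ.symm.injective (Fin.ext hij), colorPoly_ne_zero _ _, rfl⟩ fun i => ?_
    rw [degree_colorPoly (sortsVariables_lexOrderOfPerm σ)]
    exact h i

/-- The initial ideal of a Specht ideal only depends on the order of the variables. -/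
theorem initialIdeal_spechtIdeal_eq (hanti : Antitone l) (hsum : ∑ i, l i = n)
    {M : MonomialOrder (Fin n)} {σ : Equiv.Perm (Fin n)} (hM : SortsVariables M σ) :
    initialIdeal M (spechtIdeal K l n) = initialIdeal (lexOrderOfPerm σ) (spechtIdeal K l n) := by
  rw [initialIdeal_eq_iff]
  refine (leadingExponents_eq_of_subset fun e he => ?_).symm
  rw [mem_leadingExponents_lexOrderOfPerm hanti hsum] at he
  obtain ⟨c, hc, h⟩ := he
  refine mem_leadingExponents_of_le
    ⟨colorPoly K c fun j => σ.symm j, colorPoly_mem_spechtIdeal K hanti hsum hc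
      fun i j hij => σ.symm.injective (Fin.ext hij), colorPoly_ne_zero _ _, rfl⟩ fun i => ?_
  rw [degree_colorPoly hM]
  exact h i

end InitialIdeal

/-! ### The order of the k + 1 largest variables is irrelevant -/

section TopVariables

variable {m n : ℕ} {l : Fin m → ℕ}

/-- The columns with indices from l (s + 1) up to l s - 1 meet exactly the rows 0, …, s, and there
are at least k of them. -/
theorem le_card_filter_colLength_eq (hanti : Antitone l) (hsum : ∑ i, l i = n) {k s : ℕ}
    (hs : s + 1 < m) (hk : l ⟨s + 1, hs⟩ + k ≤ l ⟨s, by omega⟩) :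
    k ≤ (Finset.univ.filter fun j : Fin n => colLength l j = s + 1).card := by
  have hn := le_of_sum_eq hsum ⟨s, by omega⟩
  have h := Finset.card_le_card_of_injOn (s := (Finset.univ : Finset (Fin k)))
    (t := Finset.univ.filter fun j : Fin n => colLength l j = s + 1)
    (fun x => ⟨l ⟨s + 1, hs⟩ + x, by omega⟩) ?_ ?_
  · simpa using h
  · intro x _
    rw [Finset.mem_coe, Finset.mem_filter]
    refine ⟨Finset.mem_univ _, ?_⟩
    have : (Finset.univ.filter fun i => l ⟨s + 1, hs⟩ + x < l i) =
        Finset.univ.filter fun i : Fin m => i.val < s + 1 := by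
      refine Finset.filter_congr fun i _ => ⟨fun h => ?_, fun h => ?_⟩
      · by_contra hi
        have := hanti (a := ⟨s + 1, hs⟩) (b := i) (Fin.le_def.2 (by simpa using hi))
        omega
      · have := hanti (a := i) (b := ⟨s, by omega⟩) (Fin.le_def.2 (by simp; omega))
        omega
    rw [colLength, this, Fin.card_filter_val_lt]
    omega
  · intro x _ y _ hxy
    simpa [Fin.ext_iff] using hxy

/-- If two of the `k + 1` elements of largest rank share a colour, then the last element of that
colour can be moved to a class without elements of large rank, which increases no height. -/
theorem exists_recoloring_step (hanti : Antitone l) (hsum : ∑ i, l i = n) {k N : ℕ}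
    (hgap : ∀ (i : ℕ) (h : i + 1 < m), l ⟨i + 1, h⟩ + k ≤ l ⟨i, by omega⟩)
    {ρ : Fin n → ℕ} (hρ : Function.Injective ρ)
    (hN : (Finset.univ.filter fun i => N ≤ ρ i).card ≤ k + 1) {c : Fin n → Fin n}
    (hc : IsDominated l c) {x y : Fin n} (hx : N ≤ ρ x) (hxy : ρ x < ρ y) (hcxy : c x = c y)
    (hmax : ∀ z, c z = c y → ρ z ≤ ρ y) :
    ∃ b, (∀ z, N ≤ ρ z → c z ≠ b) ∧ IsDominated l (Function.update c y b) ∧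
      ∀ i, height (Function.update c y b) ρ i ≤ height c ρ i := by
  have hxne : x ≠ y := by
    rintro rfl
    omega
  set q : Fin n → ℕ := fun j => colLength l j with hq
  have hqt : ∀ t, truncSum q t = rowSum l t := truncSum_colLength hanti hsum
  have hc' : ∀ t, truncSum (colorCard c) t ≤ truncSum q t := fun t => by
    rw [hqt]
    exact hc t
  set u := colorCard c (c y) with hu
  have hu2 : 2 ≤ u := by
    have : ({x, y} : Finset (Fin n)) ⊆ Finset.univ.filter fun i => c i = c y := by
      intro z hz
      simp only [Finset.mem_insert, Finset.mem_singleton] at hz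
      rcases hz with rfl | rfl <;> simp [hcxy]
    have := Finset.card_le_card this
    rwa [Finset.card_pair hxne] at this
  -- With s the last agreement of truncated sums up to u - 1, there is slack strictly between s and
  -- u. Moving y from its class of size u to any class of size s therefore preserves dominance.
  let P : ℕ → Prop := fun t => truncSum (colorCard c) t = truncSum q t
  have hs1 : P (Nat.findGreatest P (u - 1)) :=
    Nat.findGreatest_spec (Nat.zero_le _) (by simp [P, truncSum_zero])
  have hs2 : Nat.findGreatest P (u - 1) ≤ u - 1 := Nat.findGreatest_le _
  have hs3 : ∀ t, Nat.findGreatest P (u - 1) < t → t ≤ u - 1 →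
      truncSum (colorCard c) t < truncSum q t := fun t h1 h2 =>
    lt_of_le_of_ne (hc' t) (Nat.findGreatest_is_greatest (P := P) h1 h2)
  set s := Nat.findGreatest P (u - 1)
  obtain ⟨b, hb, hbB⟩ : ∃ b, colorCard c b = s ∧ ∀ z, N ≤ ρ z → c z ≠ b := by
    rcases Nat.eq_zero_or_pos s with h0 | h0
    · obtain ⟨b, hb⟩ := exists_eq_of_truncSum_lt_succ hc' hs1 (hs3 _ (by omega) (by omega))
      refine ⟨b, hb, fun z _ hz => ?_⟩
      rw [h0, colorCard, Finset.card_eq_zero, Finset.filter_eq_empty_iff] at hb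
      exact hb (Finset.mem_univ z) hz
    · have hsm : s < m := by
        by_contra hsm
        have h1 := truncSum_succ (colorCard c) s
        have h2 := truncSum_le_sum (colorCard c) (s + 1)
        rw [sum_colorCard, Fintype.card_fin] at h2
        have h3 : truncSum (colorCard c) s = n := by
          rw [hs1, hqt, rowSum_of_le hsum (not_lt.1 hsm)]
        have h4 : 0 < (Finset.univ.filter fun j => s < colorCard c j).card :=
          Finset.card_pos.2 ⟨c y, by simp; omega⟩
        omega
      -- Agreement at s gives at least as many colours of class size s as columns of length s, hence
      -- at least k. The at most k + 1 top elements have a repeated colour, so they use at most k -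
      -- 1 colours besides that of y; some class of size s contains none of them.
      obtain ⟨r, hr⟩ : ∃ r, s = r + 1 := ⟨s - 1, by omega⟩
      have hk := (le_card_filter_colLength_eq hanti hsum (hr ▸ hsm) (hgap r (hr ▸ hsm))).trans_eq
        (by rw [← hr])
      have hk' := hk.trans (card_filter_eq_le_of_truncSum_eq hc' hs1)
      set B := Finset.univ.filter fun i => N ≤ ρ i with hB
      have hcB : (B.image c).card < B.card := by
        refine lt_of_le_of_ne Finset.card_image_le fun h => hxne ?_
        exact Finset.card_image_iff.1 h (by simpa [hB] using hx) (by simp [hB]; omega) hcxy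
      have hyB : c y ∈ B.image c := Finset.mem_image_of_mem _ (by simp [hB]; omega)
      have hcard := Finset.card_erase_add_one hyB
      obtain ⟨b, hb, hbB⟩ := Finset.exists_mem_notMem_of_card_lt_card
        (s := (B.image c).erase (c y)) (t := Finset.univ.filter fun j => colorCard c j = s)
        (by omega)
      simp only [Finset.mem_filter, Finset.mem_univ, true_and] at hb
      refine ⟨b, hb, fun z hz hzb => hbB ?_⟩
      rw [Finset.mem_erase]
      refine ⟨?_, Finset.mem_image.2 ⟨z, by simpa [hB] using hz, hzb⟩⟩
      rintro rfl
      omega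
  have hyN : N ≤ ρ y := by omega
  have hne : c y ≠ b := hbB y hyN
  refine ⟨b, hbB, fun t => ?_, fun i => ?_⟩
  · rw [truncSum_colorCard_update c hne (by omega), ← hqt]
    split_ifs with h
    · exact hs3 t (by omega) (by omega)
    · exact hc' t
  · by_cases hi : i = y
    · subst hi
      -- The moved element was the last of its class, so its height was u - 1, which is at least s.
      have h1 : height (Function.update c i b) ρ i ≤ s := by
        rw [← hb, colorCard, height]
        refine Finset.card_le_card fun j hj => ?_
        simp only [Finset.mem_filter, Finset.mem_univ, true_and, Function.update_self] at hj ⊢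
        rw [← hj.1, Function.update_of_ne]
        rintro rfl
        exact lt_irrefl _ hj.2
      have h2 : u = height c ρ i + 1 := by
        rw [hu, colorCard, height, ← Finset.card_erase_add_one (a := i) (by simp)]
        congr 2
        ext j
        simp only [Finset.mem_erase, Finset.mem_filter, Finset.mem_univ, true_and]
        constructor
        · rintro ⟨h3, h4⟩
          exact ⟨h4, lt_of_le_of_ne (hmax j h4) fun e => h3 (hρ e)⟩
        · rintro ⟨h3, h4⟩
          refine ⟨?_, h3⟩
          rintro rfl
          exact lt_irrefl _ h4
      omega
    -- Other elements gain nothing: members of the class b have rank below N, hence below y.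
    · refine Finset.card_le_card fun j hj => ?_
      simp only [Finset.mem_filter, Finset.mem_univ, true_and, Function.update_of_ne hi] at hj ⊢
      by_cases hj' : j = y
      · subst hj'
        rw [Function.update_self] at hj
        exact absurd hj.1.symm (hbB i (by omega))
      · rwa [Function.update_of_ne hj'] at hj

theorem exists_injOn_recoloring (hanti : Antitone l) (hsum : ∑ i, l i = n) {k N : ℕ}
    (hgap : ∀ (i : ℕ) (h : i + 1 < m), l ⟨i + 1, h⟩ + k ≤ l ⟨i, by omega⟩)
    {ρ : Fin n → ℕ} (hρ : Function.Injective ρ)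
    (hN : (Finset.univ.filter fun i => N ≤ ρ i).card ≤ k + 1) (c : Fin n → Fin n)
    (hc : IsDominated l c) :
    ∃ c' : Fin n → Fin n, IsDominated l c' ∧ (∀ i, height c' ρ i ≤ height c ρ i) ∧
      ∀ x y, N ≤ ρ x → N ≤ ρ y → c' x = c' y → x = y := by
  set B := Finset.univ.filter fun i => N ≤ ρ i with hB
  -- Each step adds the new colour b to those of the top elements, and the old colour of y survives
  -- at x, so the number of top colours grows.
  induction' hd : n - (B.image c).card using Nat.strong_induction_on with d ih generalizing c
  by_cases hinj : ∀ x y, N ≤ ρ x → N ≤ ρ y → c x = c y → x = y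
  · exact ⟨c, hc, fun i => le_rfl, hinj⟩
  push Not at hinj
  obtain ⟨x₁, x₂, hx₁, hx₂, hcx, hne⟩ := hinj
  obtain ⟨y, hy, hmax⟩ := Finset.exists_max_image (Finset.univ.filter fun i => c i = c x₁) ρ
    ⟨x₁, by simp⟩
  simp only [Finset.mem_filter, Finset.mem_univ, true_and] at hy hmax
  obtain ⟨x, hx, hxy, hcxy⟩ : ∃ x, N ≤ ρ x ∧ ρ x < ρ y ∧ c x = c y := by
    by_cases h : x₁ = y
    · refine ⟨x₂, hx₂, lt_of_le_of_ne (hmax _ hcx.symm) fun e => hne ?_, by rw [hy, hcx]⟩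
      rw [h, hρ e]
    · exact ⟨x₁, hx₁, lt_of_le_of_ne (hmax _ rfl) fun e => h (hρ e), hy.symm⟩
  obtain ⟨b, hbB, hdom, hht⟩ := exists_recoloring_step hanti hsum hgap hρ hN hc hx hxy hcxy
    (fun z hz => hmax z (hz.trans hy))
  have hlt : (B.image c).card < (B.image (Function.update c y b)).card := by
    refine Finset.card_lt_card ⟨fun j hj => ?_, fun hsub => ?_⟩
    · obtain ⟨z, hz, rfl⟩ := Finset.mem_image.1 hj
      by_cases hzy : z = y
      · subst hzy
        refine Finset.mem_image.2 ⟨x, by simpa [hB] using hx, ?_⟩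
        rw [Function.update_of_ne, hcxy]
        rintro rfl
        exact lt_irrefl _ hxy
      · exact Finset.mem_image.2 ⟨z, hz, Function.update_of_ne hzy _ _⟩
    · have hbmem : b ∈ B.image (Function.update c y b) :=
        Finset.mem_image.2 ⟨y, by simp [hB]; omega, by simp⟩
      obtain ⟨z, hz, hzb⟩ := Finset.mem_image.1 (hsub hbmem)
      exact hbB z (by simpa [hB] using hz) hzb
  have hle : (B.image (Function.update c y b)).card ≤ n :=
    (Finset.card_le_univ _).trans (by simp)
  obtain ⟨c', h1, h2, h3⟩ := ih _ (by omega) _ hdom rfl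
  exact ⟨c', h1, fun i => (h2 i).trans (hht i), h3⟩

theorem leadingExponents_subset_of_agree {K : Type*} [Field K] (hanti : Antitone l)
    (hsum : ∑ i, l i = n) {k : ℕ}
    (hgap : ∀ (i : ℕ) (h : i + 1 < m), l ⟨i + 1, h⟩ + k ≤ l ⟨i, by omega⟩)
    {σ τ : Equiv.Perm (Fin n)} (h : ∀ i : Fin n, (i : ℕ) + k + 1 < n → σ i = τ i) :
    leadingExponents (lexOrderOfPerm σ) (spechtIdeal K l n) ⊆
      leadingExponents (lexOrderOfPerm τ) (spechtIdeal K l n) := by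
  intro e he
  rw [mem_leadingExponents_lexOrderOfPerm hanti hsum] at he ⊢
  obtain ⟨c, hc, hce⟩ := he
  have hB : (Finset.univ.filter fun i => n - (k + 1) ≤ (σ.symm i : ℕ)).card ≤ k + 1 := by
    have h1 : (Finset.univ.filter fun i => n - (k + 1) ≤ (σ.symm i : ℕ)).card ≤
        (Finset.Ico (n - (k + 1)) n).card := by
      refine Finset.card_le_card_of_injOn (fun i => (σ.symm i : ℕ)) ?_ ?_
      · intro i hi
        simpa using hi
      · intro i _ j _ hij
        exact σ.symm.injective (Fin.ext hij)
    rw [Nat.card_Ico] at h1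
    omega
  obtain ⟨c', hc', hht, hinj⟩ := exists_injOn_recoloring hanti hsum hgap
    (ρ := fun i => (σ.symm i : ℕ)) (fun i j hij => σ.symm.injective (Fin.ext hij)) hB c hc
  have hlow : ∀ i, (σ.symm i : ℕ) + k + 1 < n → τ.symm i = σ.symm i := by
    intro i hi
    rw [Equiv.symm_apply_eq, ← h _ hi, Equiv.apply_symm_apply]
  have hlow' : ∀ i, (τ.symm i : ℕ) + k + 1 < n → τ.symm i = σ.symm i := by
    intro i hi
    rw [eq_comm, Equiv.symm_apply_eq, h _ hi, Equiv.apply_symm_apply]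
  refine ⟨c', hc', fun i => le_trans (le_of_eq ?_) ((hht i).trans (hce i))⟩
  rw [height, height]
  congr 1
  -- The two orders can disagree only on a pair of top elements, and top elements of the same colour
  -- now coincide.
  refine Finset.filter_congr fun j _ => and_congr_right fun hcj => ?_
  by_cases hi : (σ.symm i : ℕ) + k + 1 < n
  · rw [hlow i hi]
    by_cases hj : (σ.symm j : ℕ) + k + 1 < n
    · rw [hlow j hj]
    · have hj' : ¬ (τ.symm j : ℕ) + k + 1 < n := fun h' => hj (hlow' j h' ▸ h')
      omega
  · have hi' : ¬ (τ.symm i : ℕ) + k + 1 < n := fun h' => hi (hlow' i h' ▸ h')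
    by_cases hj : (σ.symm j : ℕ) + k + 1 < n
    · rw [hlow j hj]
      omega
    · obtain rfl := hinj j i (by omega) (by omega) hcj
      simp

end TopVariables

/-! ### Ballot words as leading exponents -/

/-- All prefixes of `e` of length at most `t` contain each letter `w` at least as often as the
letter `w + 1`. -/
def IsBallot (e : ℕ → ℕ) (t : ℕ) : Prop := ∀ s ≤ t, Antitone (occ e s)

section Ballot

theorem isBallot_zero (e : ℕ → ℕ) : IsBallot e 0 := by
  intro s hs w w' _
  obtain rfl : s = 0 := by omega
  simp [occ_zero]

theorem IsBallot.mono {e : ℕ → ℕ} {s t : ℕ} (h : IsBallot e t) (hst : s ≤ t) : IsBallot e s :=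
  fun r hr => h r (hr.trans hst)

theorem IsBallot.congr {e e' : ℕ → ℕ} {t : ℕ} (h : IsBallot e t) (he : ∀ s < t, e' s = e s) :
    IsBallot e' t := by
  intro s hs w w' hw
  rw [occ_congr (fun r hr => he r (by omega)), occ_congr (fun r hr => he r (by omega))]
  exact h s hs hw

theorem occ_update {V : Type*} [DecidableEq V] (e : ℕ → V) (t : ℕ) (x w : V) :
    occ (Function.update e t x) (t + 1) w = occ e t w + if x = w then 1 else 0 := by
  rw [occ_succ, Function.update_self,
    occ_congr (fun s hs => Function.update_of_ne (ne_of_lt hs) _ _)]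

theorem IsBallot.update {e : ℕ → ℕ} {t x : ℕ} (h : IsBallot e t)
    (hx : ∀ y, x = y + 1 → occ e t x < occ e t y) : IsBallot (Function.update e t x) (t + 1) := by
  intro s hs
  rcases hs.lt_or_eq with h1 | rfl
  · exact h.congr (fun s hs => Function.update_of_ne (ne_of_lt hs) _ _) s (by omega)
  · refine antitone_nat_of_succ_le fun w => ?_
    rw [occ_update, occ_update]
    have h1 := h t le_rfl (Nat.le_add_right w 1)
    have h2 := hx w
    split_ifs with h3 h4 h4
    · omega
    · subst h3
      have := h2 rfl
      omega
    · omega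
    · omega

theorem sum_occ {e : ℕ → ℕ} {t N : ℕ} (h : ∀ w, N ≤ w → occ e t w = 0) :
    ∑ w ∈ Finset.range N, occ e t w = t := by
  conv_rhs => rw [← Finset.card_range t]
  rw [Finset.card_eq_sum_card_fiberwise (f := e) (t := Finset.range N)]
  · rfl
  · intro s hs
    have hs' : s < t := by simpa using hs
    simp only [Finset.coe_range, Set.mem_Iio]
    by_contra hle
    have h1 := h _ (not_lt.1 hle)
    have h2 := occ_lt_occ e hs'
    omega

theorem card_filter_lt_eq_sum_occ (e : ℕ → ℕ) (n t : ℕ) :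
    ((Finset.range n).filter fun s => e s < t).card = ∑ w ∈ Finset.range t, occ e n w := by
  rw [Finset.card_eq_sum_card_fiberwise (f := e) (t := Finset.range t) (by intro s; simp)]
  refine Finset.sum_congr rfl fun w hw => ?_
  rw [occ]
  congr 1
  ext s
  simp only [Finset.mem_filter, Finset.mem_range] at hw ⊢
  constructor
  · rintro ⟨⟨h1, h2⟩, h3⟩
    exact ⟨h1, h3⟩
  · rintro ⟨h1, rfl⟩
    exact ⟨⟨h1, hw⟩, rfl⟩

/-- A ballot word whose letter counts are contained in a partition `β` can be extended to a ballot
word with letter counts `β`. -/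
theorem exists_extension {N : ℕ} {β : ℕ → ℕ} (hβ : Antitone β) (hN : ∀ w, N ≤ w → β w = 0)
    {e₀ : ℕ → ℕ} {t₀ : ℕ} (hb : IsBallot e₀ t₀) (hle : ∀ w, occ e₀ t₀ w ≤ β w) :
    ∃ e, (∀ s < t₀, e s = e₀ s) ∧ t₀ ≤ ∑ w ∈ Finset.range N, β w ∧
      IsBallot e (∑ w ∈ Finset.range N, β w) ∧
      ∀ w, occ e (∑ w ∈ Finset.range N, β w) w = β w := by
  have hsum : ∑ w ∈ Finset.range N, occ e₀ t₀ w = t₀ :=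
    sum_occ fun w hw => Nat.le_zero.1 ((hle w).trans_eq (hN w hw))
  have hle' : t₀ ≤ ∑ w ∈ Finset.range N, β w := by
    rw [← hsum]
    exact Finset.sum_le_sum fun w _ => hle w
  induction' hd : ∑ w ∈ Finset.range N, β w - t₀ with d ih generalizing e₀ t₀
  · have heq : t₀ = ∑ w ∈ Finset.range N, β w := by omega
    have hall : ∀ w, occ e₀ t₀ w = β w := by
      intro w
      rcases lt_or_ge w N with hw | hw
      · exact (Finset.sum_eq_sum_iff_of_le fun w _ => hle w).1 (hsum.trans heq) w
          (Finset.mem_range.2 hw)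
      · have := hle w
        have := hN w hw
        omega
    exact ⟨e₀, fun _ _ => rfl, hle', heq ▸ hb, heq ▸ hall⟩
  · have hex : ∃ x, occ e₀ t₀ x < β x := by
      by_contra hno
      push Not at hno
      have : ∑ w ∈ Finset.range N, β w ≤ t₀ := by
        rw [← hsum]
        exact Finset.sum_le_sum fun w _ => hno w
      omega
    -- Append the smallest letter x that still has room. Smaller letters y are already full, so occ
    -- x < β x ≤ β y ≤ occ y and the word stays ballot.
    have hx := Nat.find_spec hex
    have hmin : ∀ y < Nat.find hex, β y ≤ occ e₀ t₀ y := fun y hy => not_lt.1 (Nat.find_min hex hy)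
    set x := Nat.find hex
    have hb' : IsBallot (Function.update e₀ t₀ x) (t₀ + 1) := hb.update fun y hy => by
      have h1 := hmin y (by omega)
      have h2 := hβ (show y ≤ x by omega)
      omega
    have hle1 : ∀ w, occ (Function.update e₀ t₀ x) (t₀ + 1) w ≤ β w := by
      intro w
      rw [occ_update]
      split_ifs with h
      · subst h
        exact hx
      · exact hle w
    obtain ⟨e, h1, -, h2⟩ := ih hb' hle1
      (sum_occ fun w hw => Nat.le_zero.1 ((hle1 w).trans_eq (hN w hw))) (by omega) (by omega)
    exact ⟨e, fun s hs => (h1 s (by omega)).trans (Function.update_of_ne hs.ne _ _), hle', h2⟩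

/-- On the way to the letter counts `β`, an additional letter `r + 1` can be inserted at any
position `q`, provided that there is room for it. -/
theorem exists_insertion {N : ℕ} {β : ℕ → ℕ} (hβ : Antitone β) (hN : ∀ w, N ≤ w → β w = 0)
    {e₀ : ℕ → ℕ} {t₀ : ℕ} (hb : IsBallot e₀ t₀) (hle : ∀ w, occ e₀ t₀ w ≤ β w) {r q : ℕ}
    (hr : β (r + 1) < occ e₀ t₀ r) (hq : t₀ ≤ q) (hq' : q ≤ ∑ w ∈ Finset.range N, β w) :
    ∃ e, (∀ s < t₀, e s = e₀ s) ∧ e q = r + 1 ∧ IsBallot e (q + 1) ∧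
      ∀ w, occ e (q + 1) w ≤ β w + if r + 1 = w then 1 else 0 := by
  obtain ⟨e, h1, -, h2, h3⟩ := exists_extension hβ hN hb hle
  have hup : ∀ w, occ e q w ≤ β w := fun w => (occ_mono e w hq').trans_eq (h3 w)
  refine ⟨Function.update e q (r + 1), fun s hs => ?_, Function.update_self _ _ _,
    (h2.mono hq').update fun y hy => ?_, fun w => ?_⟩
  · rw [Function.update_of_ne (by omega), h1 s hs]
  · obtain rfl : r = y := by omega
    refine (hup _).trans_lt (hr.trans_le ?_)
    rw [← occ_congr h1]
    exact occ_mono e r hq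
  · rw [occ_update]
    exact Nat.add_le_add_right (hup w) _

/-- In a ballot word, the height of each position in its column is its letter. -/
theorem height_wordColoring_of_isBallot {n : ℕ} (σ : Equiv.Perm (Fin n)) {e : ℕ → ℕ}
    (he : IsBallot e n) (i : Fin n) :
    height (wordColoring σ e) (fun j => σ.symm j) i = e (σ.symm i) := by
  rw [height_wordColoring]
  conv_rhs => rw [← Finset.card_range (e (σ.symm i))]
  set t := (σ.symm i).val with ht
  have htn : t < n := (σ.symm i).2
  -- The ballot condition at t gives one direction. The other uses t + 1, where the letter `e t` has
  -- just gained an occurrence and still must not exceed smaller letters.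
  have key : ∀ w, occ e t (e t) < occ e t w ↔ w < e t := by
    intro w
    constructor
    · intro h
      by_contra hw
      exact absurd (he t htn.le (not_lt.1 hw)) (not_le.2 h)
    · intro h
      have h1 := he (t + 1) htn h.le
      rw [occ_succ, occ_succ, if_pos rfl, if_neg h.ne'] at h1
      omega
  congr 1
  ext w
  rw [Finset.mem_filter, key, Finset.mem_range, and_iff_right_iff_imp]
  intro hw
  obtain ⟨s, hs, rfl, -⟩ := exists_occ_eq e ((Nat.zero_le _).trans_lt ((key w).2 hw))
  exact Finset.mem_image_of_mem _ (Finset.mem_range.2 hs)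

variable {m n : ℕ} {l : Fin m → ℕ}

/-- The row lengths of the diagram, extended by zero. -/
def rowLength (l : Fin m → ℕ) (w : ℕ) : ℕ := if h : w < m then l ⟨w, h⟩ else 0

theorem rowLength_of_lt (l : Fin m → ℕ) {w : ℕ} (h : w < m) : rowLength l w = l ⟨w, h⟩ := dif_pos h

theorem rowLength_of_le (l : Fin m → ℕ) {w : ℕ} (h : m ≤ w) : rowLength l w = 0 :=
  dif_neg (not_lt.2 h)

theorem antitone_rowLength (hanti : Antitone l) : Antitone (rowLength l) := by
  intro a b hab
  by_cases hb : b < m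
  · rw [rowLength_of_lt l hb, rowLength_of_lt l (hab.trans_lt hb)]
    exact hanti (Fin.le_def.2 hab)
  · rw [rowLength_of_le l (not_lt.1 hb)]
    exact Nat.zero_le _

theorem rowSum_eq_sum_range (l : Fin m → ℕ) (t : ℕ) :
    rowSum l t = ∑ w ∈ Finset.range t, rowLength l w := by
  induction t with
  | zero => simp [rowSum]
  | succ t ih =>
    rw [Finset.sum_range_succ, ← ih]
    by_cases ht : t < m
    · rw [rowSum_succ ht, rowLength_of_lt l ht]
    · rw [rowLength_of_le l (not_lt.1 ht), rowSum_of_le rfl (not_lt.1 ht),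
        rowSum_of_le rfl (by omega), add_zero]

/-- A ballot word whose letter counts in the first `m` rows are bounded by `l` gives a leading
exponent of the Specht ideal. -/
theorem mem_leadingExponents_of_isBallot (K : Type*) [Field K] (hanti : Antitone l)
    (hsum : ∑ i, l i = n) (σ : Equiv.Perm (Fin n)) {e : ℕ → ℕ} (he : IsBallot e n)
    (hle : ∀ w < m, occ e n w ≤ rowLength l w) :
    (Finsupp.equivFunOnFinite.symm fun i => e (σ.symm i)) ∈
      leadingExponents (lexOrderOfPerm σ) (spechtIdeal K l n) := by
  rw [mem_leadingExponents_lexOrderOfPerm hanti hsum]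
  refine ⟨wordColoring σ e, fun t => ?_, fun i => (height_wordColoring_of_isBallot σ he i).le⟩
  rw [truncSum_colorCard_eq _ (ρ := fun j => (σ.symm j : ℕ))
    fun i j _ h => σ.symm.injective (Fin.ext h)]
  simp only [height_wordColoring_of_isBallot σ he]
  have hcard : (Finset.univ.filter fun i : Fin n => e (σ.symm i) < t).card =
      ((Finset.range n).filter fun s => e s < t).card := by
    refine Finset.card_bij (fun i _ => (σ.symm i : ℕ)) ?_ ?_ ?_
    · intro i hi
      simpa using hi
    · intro i _ j _ h
      exact σ.symm.injective (Fin.ext h)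
    · intro s hs
      simp only [Finset.mem_filter, Finset.mem_range] at hs
      exact ⟨σ ⟨s, hs.1⟩, by simpa using hs.2, by simp⟩
  rw [hcard]
  -- Letters from m on need no bound, because for t ≥ m the row sum is already n.
  rcases le_total t m with ht | ht
  · rw [card_filter_lt_eq_sum_occ, rowSum_eq_sum_range]
    exact Finset.sum_le_sum fun w hw => hle w ((Finset.mem_range.1 hw).trans_le ht)
  · rw [rowSum_of_le hsum ht]
    exact (Finset.card_filter_le _ _).trans (by simp)

end Ballot

/-! ### Construction of separating words -/

section SeparatingWords

variable {m n : ℕ} {l : Fin m → ℕ}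

/-- The word `e` is a ballot word of dominated shape with full rows `0, …, r`. Its first `p`
letters leave no room in row `r + 1`, while its letter at position `q` lies in this row (or, if
row `r` is still empty at position `p`, possibly below). -/
def IsSeparating (l : Fin m → ℕ) (n p q r : ℕ) (e : ℕ → ℕ) : Prop :=
  IsBallot e n ∧ (∀ w < m, occ e n w ≤ rowLength l w) ∧
    (∀ w ≤ r, occ e n w = rowLength l w) ∧
    ((occ e p r = 0 ∧ r + 1 ≤ e q) ∨ (occ e p r ≤ occ e p (r + 1) ∧ e q = r + 1))

theorem sum_range_ite_lt (f : ℕ → ℕ) {j N : ℕ} (h : j ≤ N) :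
    ∑ w ∈ Finset.range N, (if w < j then f w else 0) = ∑ w ∈ Finset.range j, f w := by
  rw [← Finset.sum_filter]
  congr 1
  ext w
  simp only [Finset.mem_filter, Finset.mem_range]
  omega

theorem antitone_ite_lt {f : ℕ → ℕ} (hf : Antitone f) (j : ℕ) :
    Antitone fun w => if w < j then f w else 0 := by
  intro a b hab
  dsimp only
  have := hf hab
  split_ifs <;> omega

theorem rowLength_pos (hpos : ∀ i, 0 < l i) {w : ℕ} (hw : w < m) : 0 < rowLength l w := by
  rw [rowLength_of_lt l hw]
  exact hpos _

theorem rowSum_mono (l : Fin m → ℕ) : Monotone (rowSum l) := by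
  intro a b hab
  rw [rowSum_eq_sum_range, rowSum_eq_sum_range]
  exact Finset.sum_le_sum_of_subset (Finset.range_subset_range.2 hab)

/-- Separating words for positions `p` such that row `r` can be empty before `p`. -/
theorem exists_isSeparating_of_le_rowSum (hanti : Antitone l) (hpos : ∀ i, 0 < l i)
    (hsum : ∑ i, l i = n) {r p q : ℕ} (hr : r + 1 < m) (hrp : r ≤ p) (hp : p ≤ rowSum l r)
    (hpq : p < q) (hq : q < n) : ∃ e, IsSeparating l n p q r e := by
  have hl := antitone_rowLength hanti
  have hβ : ∀ j, Antitone fun w => if w < j then rowLength l w else 0 := antitone_ite_lt hl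
  have hN : ∀ j, j ≤ m → ∀ w, m ≤ w → (if w < j then rowLength l w else 0) = 0 :=
    fun j hj w hw => if_neg (by omega)
  have hS : ∀ j, j ≤ m → ∑ w ∈ Finset.range m, (if w < j then rowLength l w else 0) =
      rowSum l j := fun j hj => by rw [sum_range_ite_lt _ hj, rowSum_eq_sum_range]
  have hSm : ∑ w ∈ Finset.range m, rowLength l w = n := by
    rw [← rowSum_eq_sum_range, rowSum_of_le hsum le_rfl]
  -- Start with one copy of each letter below r, which makes r admissible at every later position;
  -- then e₁ fills rows 0, …, r - 1, so that r does not occur before p.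
  obtain ⟨e₀, -, -, h0, h0'⟩ := exists_extension (N := m) (β := fun w => if w < r then 1 else 0)
    (antitone_ite_lt (f := fun _ => 1) antitone_const r) (fun w hw => if_neg (by omega))
    (e₀ := fun _ => 0) (isBallot_zero _) (fun w => by simp [occ_zero])
  rw [sum_range_ite_lt (fun _ => 1) (by omega : r ≤ m)] at h0 h0'
  simp only [Finset.sum_const, Finset.card_range, smul_eq_mul, mul_one] at h0 h0'
  obtain ⟨e₁, h1, -, h1b, h1c⟩ := exists_extension (hβ r) (hN r (by omega)) h0 (fun w => by
    rw [h0']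
    split_ifs with hw
    · exact rowLength_pos hpos (by omega)
    · exact le_rfl)
  rw [hS r (by omega)] at h1b h1c
  have hp1 : ∀ w, occ e₁ p w ≤ if w < r then rowLength l w else 0 :=
    fun w => (occ_mono e₁ w hp).trans_eq (h1c w)
  have hpr : occ e₁ p r = 0 := by simpa using hp1 r
  have hpr' : ∀ w < r, 1 ≤ occ e₁ p w := by
    intro w hw
    have h2 := h0' w
    rw [if_pos hw, ← occ_congr h1] at h2
    rw [← h2]
    exact occ_mono e₁ w hrp
  have h2 : IsBallot (Function.update e₁ p r) (p + 1) := (h1b.mono hp).update fun y hy => by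
    have := hpr' y (by omega)
    omega
  have h2c : ∀ w, occ (Function.update e₁ p r) (p + 1) w ≤
      if w < r + 1 then rowLength l w else 0 := by
    intro w
    rw [occ_update]
    have h3 := hp1 w
    split_ifs at h3 ⊢ with h4 h5 h6 h7
    · omega
    · have := rowLength_pos hpos (l := l) (w := w) (by omega)
      omega
    · omega
    all_goals omega
  set e₂ := Function.update e₁ p r with he₂
  have h2p : ∀ s < p, e₂ s = e₁ s := fun s hs => Function.update_of_ne hs.ne _ _
  -- If q comes early, r + 1 is inserted there, supported by the r placed at p. If q comes late,
  -- rows 0, …, r are completely filled before q, so the letter at q is automatically at least r +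
  -- 1.
  rcases le_or_gt q (rowSum l (r + 1)) with hqr | hqr
  · obtain ⟨e₃, h3, h3q, h3b, h3c⟩ := exists_insertion (hβ (r + 1)) (hN (r + 1) (by omega)) h2 h2c
      (r := r) (q := q) (by simp [he₂, occ_update]) hpq (by rw [hS _ (by omega)]; exact hqr)
    obtain ⟨e₄, h4, -, h4b, h4c⟩ := exists_extension (N := m) hl
      (fun w hw => rowLength_of_le l hw) h3b (fun w => (h3c w).trans (by
        split_ifs with h5 h6 h6
        · omega
        · omega
        · subst h6
          exact rowLength_pos hpos hr
        · omega))
    rw [hSm] at h4b h4c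
    refine ⟨e₄, h4b, fun w _ => (h4c w).le, fun w _ => h4c w, Or.inl ⟨?_, ?_⟩⟩
    · rw [← hpr, occ_congr fun s hs => ?_]
      rw [h4 s (by omega), h3 s (by omega), h2p s hs]
    · rw [h4 q (by omega), h3q]
  · obtain ⟨e₃, h3, h3t, h3b, h3c⟩ := exists_extension (hβ (r + 1)) (hN (r + 1) (by omega)) h2 h2c
    rw [hS _ (by omega)] at h3t h3b h3c
    obtain ⟨e₄, h4, -, h4b, h4c⟩ := exists_extension (N := m) hl
      (fun w hw => rowLength_of_le l hw) h3b (fun w => by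
        rw [h3c]
        split_ifs <;> omega)
    rw [hSm] at h4b h4c
    refine ⟨e₄, h4b, fun w _ => (h4c w).le, fun w _ => h4c w, Or.inl ⟨?_, ?_⟩⟩
    · rw [← hpr, occ_congr fun s hs => ?_]
      rw [h4 s (by omega), h3 s (by omega), h2p s hs]
    · by_contra hlt
      have h5 := occ_lt_occ e₄ hq
      have h6 := h3c (e₄ q)
      rw [if_pos (by omega), ← occ_congr h4] at h6
      have h7 := occ_mono e₄ (e₄ q) hqr.le
      have h8 := h4c (e₄ q)
      dsimp only at h7
      omega

/-- Separating words for positions `p` such that rows `r` and `r + 1` can be filled equally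
before `p`. -/
theorem exists_isSeparating_of_le (hanti : Antitone l) (hpos : ∀ i, 0 < l i)
    (hsum : ∑ i, l i = n) {r p q v : ℕ} (hr : r + 1 < m) (hv : 2 ≤ v)
    (hvl : v ≤ rowLength l (r + 1)) (hp : v * r + 2 * (v - 1) ≤ p)
    (hp' : p + rowLength l r + 2 ≤ n + v) (hpq : p < q) (hq : q < n) :
    ∃ e, IsSeparating l n p q r e := by
  have hl := antitone_rowLength hanti
  have hSr := fun j => rowSum_eq_sum_range l j
  have hn : rowSum l (r + 2) ≤ n := (rowSum_mono l (by omega)).trans_eq (rowSum_of_le hsum le_rfl)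
  have hs1 : rowSum l (r + 1) = rowSum l r + rowLength l r := by
    rw [hSr, hSr, Finset.sum_range_succ]
  have hs2 : rowSum l (r + 2) = rowSum l (r + 1) + rowLength l (r + 1) := by
    rw [hSr, hSr, Finset.sum_range_succ]
  have hlr : rowLength l (r + 1) ≤ rowLength l r := hl (by omega)
  -- The final shape has full rows 0, …, r, then v letters in row r + 1, and the remaining W letters
  -- in rows of length 1 below. This tail provides filler before p, and it may extend below row m -
  -- 1.
  obtain ⟨W, hW⟩ : ∃ W, n = rowSum l (r + 1) + v + W :=
    ⟨n - rowSum l (r + 1) - v, by omega⟩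
  have hsplit : ∀ f : ℕ → ℕ, ∑ w ∈ Finset.range (r + 2 + W), f w =
      ∑ w ∈ Finset.range r, f w + f r + f (r + 1) + ∑ x ∈ Finset.range W, f (r + 2 + x) := by
    intro f
    rw [Finset.sum_range_add, Finset.sum_range_succ, Finset.sum_range_succ]
  -- the smallest and largest possible letter counts at position `p`
  let α₀ : ℕ → ℕ := fun w => if w < r then v else if w ≤ r + 1 then v - 1 else 0
  let α₁ : ℕ → ℕ := fun w => if w < r then rowLength l w else if w ≤ r + 1 then v - 1 else
    if w < r + 2 + W then 1 else 0
  -- β is the final shape μ with one letter r + 1 missing: that letter is inserted at q, after the r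
  -- at position p has raised the count of r from v - 1 to v.
  let β : ℕ → ℕ := fun w => if w < r + 1 then rowLength l w else if w ≤ r + 1 then v - 1 else
    if w < r + 2 + W then 1 else 0
  let μ : ℕ → ℕ := fun w => if w < r + 1 then rowLength l w else if w ≤ r + 1 then v else
    if w < r + 2 + W then 1 else 0
  have hlv : ∀ w ≤ r + 1, v ≤ rowLength l w := fun w hw => hvl.trans (hl hw)
  have hα₀ : Antitone α₀ := by
    intro a b hab
    dsimp only [α₀]
    split_ifs <;> omega
  have hα₁ : Antitone α₁ := by
    intro a b hab
    have h1 := hl hab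
    have h2 := hlv a
    dsimp only [α₁]
    split_ifs <;> omega
  have hβ : Antitone β := by
    intro a b hab
    have h1 := hl hab
    have h2 := hlv a
    dsimp only [β]
    split_ifs <;> omega
  have hμ : Antitone μ := by
    intro a b hab
    have h1 := hl hab
    have h2 := hlv a
    dsimp only [μ]
    split_ifs <;> omega
  have sα₀ : ∑ w ∈ Finset.range (r + 2 + W), α₀ w = v * r + 2 * (v - 1) := by
    rw [hsplit, Finset.sum_congr rfl (g := fun _ => v) fun w hw => if_pos (Finset.mem_range.1 hw),
      Finset.sum_congr rfl (g := fun _ => 0) (s₁ := Finset.range W) fun x _ => by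
        dsimp only [α₀]
        rw [if_neg (by omega), if_neg (by omega)]]
    simp only [α₀, Finset.sum_const, Finset.card_range, smul_eq_mul]
    rw [if_neg (by omega), if_pos (by omega), if_neg (by omega), if_pos (by omega), mul_comm r v]
    omega
  have sα₁ : ∑ w ∈ Finset.range (r + 2 + W), α₁ w = rowSum l r + 2 * (v - 1) + W := by
    rw [hsplit, Finset.sum_congr rfl (g := fun w => rowLength l w)
      fun w hw => if_pos (Finset.mem_range.1 hw), ← hSr,
      Finset.sum_congr rfl (g := fun _ => 1) (s₁ := Finset.range W) fun x hx => by
        rw [Finset.mem_range] at hx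
        dsimp only [α₁]
        rw [if_neg (by omega), if_neg (by omega), if_pos (by omega)]]
    simp only [α₁, Finset.sum_const, Finset.card_range, smul_eq_mul]
    rw [if_neg (by omega), if_pos (by omega), if_neg (by omega), if_pos (by omega)]
    omega
  have sβ : ∑ w ∈ Finset.range (r + 2 + W), β w = n - 1 := by
    rw [hsplit, Finset.sum_congr rfl (g := fun w => rowLength l w)
      fun w hw => if_pos (by have := Finset.mem_range.1 hw; omega), ← hSr,
      Finset.sum_congr rfl (g := fun _ => 1) (s₁ := Finset.range W) fun x hx => by
        rw [Finset.mem_range] at hx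
        dsimp only [β]
        rw [if_neg (by omega), if_neg (by omega), if_pos (by omega)]]
    simp only [β, Finset.sum_const, Finset.card_range, smul_eq_mul]
    rw [if_pos (by omega), if_neg (by omega), if_pos (by omega)]
    omega
  have sμ : ∑ w ∈ Finset.range (r + 2 + W), μ w = n := by
    rw [hsplit, Finset.sum_congr rfl (g := fun w => rowLength l w)
      fun w hw => if_pos (by have := Finset.mem_range.1 hw; omega), ← hSr,
      Finset.sum_congr rfl (g := fun _ => 1) (s₁ := Finset.range W) fun x hx => by
        rw [Finset.mem_range] at hx
        dsimp only [μ]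
        rw [if_neg (by omega), if_neg (by omega), if_pos (by omega)]]
    simp only [μ, Finset.sum_const, Finset.card_range, smul_eq_mul]
    rw [if_pos (by omega), if_neg (by omega), if_pos (by omega)]
    omega
  obtain ⟨e₀, -, -, h0, h0'⟩ := exists_extension (N := r + 2 + W) hα₀
    (fun w hw => by dsimp only [α₀]; rw [if_neg (by omega), if_neg (by omega)])
    (e₀ := fun _ => 0) (isBallot_zero _) (fun w => by simp [occ_zero])
  rw [sα₀] at h0 h0'
  obtain ⟨e₁, h1, -, h1b, h1c⟩ := exists_extension (N := r + 2 + W) hα₁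
    (fun w hw => by
      dsimp only [α₁]; rw [if_neg (by omega), if_neg (by omega), if_neg (by omega)]) h0
    (fun w => by
      rw [h0']
      have := hlv w
      dsimp only [α₀, α₁]
      split_ifs <;> omega)
  rw [sα₁] at h1b h1c
  have hpS : p ≤ rowSum l r + 2 * (v - 1) + W := by omega
  have hp1 : ∀ w, occ e₁ p w ≤ α₁ w := fun w => (occ_mono e₁ w hpS).trans_eq (h1c w)
  have hp0 : ∀ w, α₀ w ≤ occ e₁ p w := by
    intro w
    rw [← h0', ← occ_congr h1]
    exact occ_mono e₁ w hp
  have hpr : occ e₁ p r = v - 1 := by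
    have h2 := hp0 r
    have h3 := hp1 r
    simp only [α₀, α₁, lt_irrefl, if_false] at h2 h3
    rw [if_pos (by omega)] at h2 h3
    omega
  have hpr1 : occ e₁ p (r + 1) = v - 1 := by
    have h2 := hp0 (r + 1)
    have h3 := hp1 (r + 1)
    simp only [α₀, α₁, le_refl, if_true] at h2 h3
    rw [if_neg (by omega)] at h2 h3
    omega
  have h2 : IsBallot (Function.update e₁ p r) (p + 1) := (h1b.mono hpS).update fun y hy => by
    have h3 := hp0 y
    simp only [α₀] at h3
    rw [if_pos (by omega)] at h3
    omega
  have h2c : ∀ w, occ (Function.update e₁ p r) (p + 1) w ≤ β w := by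
    intro w
    rw [occ_update]
    have h3 := hp1 w
    have h4 := hlv w
    dsimp only [α₁, β] at h3 ⊢
    split_ifs at h3 ⊢ <;> omega
  obtain ⟨e₃, h3, h3q, h3b, h3c⟩ := exists_insertion (N := r + 2 + W) hβ (fun w hw => by
      dsimp only [β]; rw [if_neg (by omega), if_neg (by omega), if_neg (by omega)]) h2 h2c
    (r := r) (q := q) (by
      rw [occ_update, hpr, if_pos rfl]
      simp only [β, le_refl, if_true]
      rw [if_neg (by omega)]
      omega) hpq (by omega)
  obtain ⟨e₄, h4, -, h4b, h4c⟩ := exists_extension (N := r + 2 + W) hμ (fun w hw => by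
      dsimp only [μ]; rw [if_neg (by omega), if_neg (by omega), if_neg (by omega)]) h3b
    (fun w => (h3c w).trans (by
      dsimp only [β, μ]
      split_ifs <;> omega))
  rw [sμ] at h4b h4c
  have hagree : ∀ s < p, e₄ s = e₁ s := fun s hs => by
    rw [h4 s (by omega), h3 s (by omega), Function.update_of_ne hs.ne]
  refine ⟨e₄, h4b, fun w hw => ?_, fun w hw => ?_, Or.inr ⟨?_, ?_⟩⟩
  · rw [h4c]
    have h5 := hlv w
    have h6 := rowLength_pos hpos hw
    dsimp only [μ]
    split_ifs <;> omega
  · rw [h4c]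
    exact if_pos (by omega)
  · rw [occ_congr hagree, occ_congr hagree, hpr, hpr1]
  · rw [h4 q (by omega), h3q]

end SeparatingWords

/-! ### Counting inequality for heights, and the obstruction it gives -/

section Heights

variable {ι γ : Type*} [Fintype ι] [DecidableEq γ] {c : ι → γ} {ρ : ι → ℕ}

theorem exists_height_eq (hρ : Function.Injective ρ) {i : ι} {v : ℕ} (hv : v < height c ρ i) :
    ∃ j, c j = c i ∧ ρ j < ρ i ∧ height c ρ j = v := by
  have h1 := card_filter_rank_lt (Finset.univ.filter fun j => c j = c i ∧ ρ j < ρ i)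
    (hρ.injOn (s := _)) (v + 1)
  have h2 := card_filter_rank_lt (Finset.univ.filter fun j => c j = c i ∧ ρ j < ρ i)
    (hρ.injOn (s := _)) v
  rw [← height] at h1 h2
  obtain ⟨j, hj, hj'⟩ := Finset.exists_mem_notMem_of_card_lt_card
    (h2.trans_lt ((by omega : min (height c ρ i) v < min (height c ρ i) (v + 1)).trans_eq h1.symm))
  simp only [Finset.mem_filter, Finset.mem_univ, true_and, not_and] at hj hj'
  have hj'' := hj' hj.1
  have heq : height c ρ j =
      ((Finset.univ.filter fun j => c j = c i ∧ ρ j < ρ i).filter fun j' => ρ j' < ρ j).card := by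
    rw [height, Finset.filter_filter]
    congr 1
    refine Finset.filter_congr fun x _ => ?_
    rw [hj.1.1]
    constructor
    · exact fun h => ⟨⟨h.1, h.2.trans hj.1.2⟩, h.2⟩
    · exact fun h => ⟨h.1.1, h.2⟩
  refine ⟨j, hj.1.1, hj.1.2, ?_⟩
  omega

theorem height_lt_height {i j : ι} (hc : c i = c j) (h : ρ i < ρ j) :
    height c ρ i < height c ρ j := by
  refine Finset.card_lt_card ⟨fun x hx => ?_, fun hsub => ?_⟩
  · simp only [Finset.mem_filter, Finset.mem_univ, true_and] at hx ⊢
    exact ⟨hx.1.trans hc, hx.2.trans h⟩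
  · have := hsub (Finset.mem_filter.2 ⟨Finset.mem_univ i, hc, h⟩)
    simp at this

theorem eq_of_height_eq (hρ : Function.Injective ρ) {i j : ι} (hc : c i = c j)
    (h : height c ρ i = height c ρ j) : i = j := by
  rcases lt_trichotomy (ρ i) (ρ j) with h1 | h1 | h1
  · exact absurd h (height_lt_height hc h1).ne
  · exact hρ h1
  · exact absurd h (height_lt_height hc.symm h1).ne'

/-- Below an element of height w, its class contains one of height v, which lies in the initial
segment `S`. Elements of equal height are distinguished by their colours, so the count can be made
on colours. -/
theorem card_filter_height_le (hρ : Function.Injective ρ) (S : Finset ι)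
    (hS : ∀ i ∈ S, ∀ j, ρ j < ρ i → j ∈ S) {v w : ℕ} (hvw : v ≤ w) :
    (S.filter fun i => height c ρ i = w).card ≤ (S.filter fun i => height c ρ i = v).card := by
  have hinj : ∀ w, Set.InjOn c (S.filter fun i => height c ρ i = w) := by
    intro w i hi j hj hij
    rw [Finset.mem_coe, Finset.mem_filter] at hi hj
    exact eq_of_height_eq hρ hij (hi.2.trans hj.2.symm)
  rw [← Finset.card_image_of_injOn (hinj w), ← Finset.card_image_of_injOn (hinj v)]
  refine Finset.card_le_card fun x hx => ?_
  obtain ⟨i, hi, rfl⟩ := Finset.mem_image.1 hx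
  rw [Finset.mem_filter] at hi
  rcases hvw.eq_or_lt with rfl | hvw
  · exact Finset.mem_image_of_mem _ (Finset.mem_filter.2 hi)
  · obtain ⟨j, h1, h2, h3⟩ := exists_height_eq hρ (hvw.trans_eq hi.2.symm)
    exact Finset.mem_image.2 ⟨j, Finset.mem_filter.2 ⟨hS i hi.1 j h2, h3⟩, h1⟩

end Heights

section Obstruction

variable {m n : ℕ} {l : Fin m → ℕ} {c : Fin n → Fin n} {ρ : Fin n → ℕ} {E : Fin n → ℕ}

/-- If the heights are bounded by `E` and `E` takes values below `r` as often as the first `r`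
rows permit, then a height is below `r` exactly if the bound is. -/
theorem height_lt_iff (hc : IsDominated l c) (hρ : Function.Injective ρ)
    (hE : ∀ i, height c ρ i ≤ E i) {r : ℕ}
    (hr : (Finset.univ.filter fun i => E i < r).card = rowSum l r) (i : Fin n) :
    height c ρ i < r ↔ E i < r := by
  have h1 := hc r
  rw [truncSum_colorCard_eq c (ρ := ρ) fun i j _ h => hρ h, ← hr] at h1
  have h2 := Finset.eq_of_subset_of_card_le
    (Finset.monotone_filter_right _ fun i _ h => (hE i).trans_lt h) h1
  have := congrArg (i ∈ ·) h2
  simpa using this.symm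

/-- Fullness of rows 0, …, r makes "at most r" equivalent for heights and for `E`. Elements with r <
E ≤ u therefore have heights in (r, u]. Each of these u - r heights occurs in `S` at most as often
as height r, and height r forces E = r. -/
theorem card_filter_le_mul (hc : IsDominated l c) (hρ : Function.Injective ρ)
    (hE : ∀ i, height c ρ i ≤ E i) {r : ℕ}
    (hr : (Finset.univ.filter fun i => E i < r + 1).card = rowSum l (r + 1)) (S : Finset (Fin n))
    (hS : ∀ i ∈ S, ∀ j, ρ j < ρ i → j ∈ S) (u : ℕ) :
    (S.filter fun i => r < E i ∧ E i ≤ u).card ≤ (u - r) * (S.filter fun i => E i = r).card := by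
  have hlt := height_lt_iff hc hρ hE hr
  have h1 : (S.filter fun i => r < E i ∧ E i ≤ u).card ≤
      (S.filter fun i => r < height c ρ i ∧ height c ρ i ≤ u).card := by
    refine Finset.card_le_card (Finset.monotone_filter_right _ fun i _ h => ?_)
    have h2 := hlt i
    have h3 := hE i
    omega
  have h2 : (S.filter fun i => height c ρ i = r).card ≤ (S.filter fun i => E i = r).card := by
    refine Finset.card_le_card (Finset.monotone_filter_right _ fun i _ h => ?_)
    have h2 := hlt i
    have h3 := hE i
    omega
  refine h1.trans ((?_ : _ ≤ (u - r) * (S.filter fun i => height c ρ i = r).card).trans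
    (Nat.mul_le_mul_left _ h2))
  rw [Finset.card_eq_sum_card_fiberwise (f := height c ρ) (t := Finset.Ioc r u)
    (by intro i; simp), ← Nat.card_Ioc, ← smul_eq_mul]
  refine Finset.sum_le_card_nsmul _ _ _ fun w hw => ?_
  refine le_trans (Finset.card_le_card fun i => ?_)
    (card_filter_height_le hρ S hS (Finset.mem_Ioc.1 hw).1.le)
  simp only [Finset.mem_filter]
  tauto

theorem card_filter_symm_lt (σ : Equiv.Perm (Fin n)) {p : ℕ} (hp : p ≤ n) (P : ℕ → Prop)
    [DecidablePred P] :
    (Finset.univ.filter fun i => (σ.symm i : ℕ) < p ∧ P (σ.symm i)).card =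
      ((Finset.range p).filter P).card := by
  refine Finset.card_bij (fun i _ => (σ.symm i : ℕ)) ?_ ?_ ?_
  · intro i hi
    simpa using hi
  · intro i _ j _ h
    exact σ.symm.injective (Fin.ext h)
  · intro s hs
    simp only [Finset.mem_filter, Finset.mem_range] at hs
    exact ⟨σ ⟨s, hs.1.trans_le hp⟩, by simpa using hs, by simp⟩

theorem card_filter_symm_eq_rowSum (σ : Equiv.Perm (Fin n)) {e : ℕ → ℕ} {r : ℕ}
    (he : ∀ w < r, occ e n w = rowLength l w) :
    (Finset.univ.filter fun i : Fin n => e (σ.symm i) < r).card = rowSum l r := by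
  rw [rowSum_eq_sum_range, ← Finset.sum_congr rfl fun w hw => he w (Finset.mem_range.1 hw),
    ← card_filter_lt_eq_sum_occ, ← card_filter_symm_lt σ le_rfl (fun s => e s < r)]
  simp

/-- The number of occurrences of a letter of the word `e`, read along `σ`, in the first `p + 1`
positions of `τ`, if `σ` and `τ` agree on the first `p` positions. -/
theorem card_filter_symm_le (σ τ : Equiv.Perm (Fin n)) (p : Fin n) (h : ∀ i < p, σ i = τ i)
    (e : ℕ → ℕ) (w : ℕ) :
    ((Finset.univ.filter fun j => τ.symm j ≤ p).filter fun j => e (σ.symm j) = w).card =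
      occ e p w + if e (σ.symm (τ p)) = w then 1 else 0 := by
  have hlt : ∀ j, τ.symm j < p ↔ σ.symm j < p := by
    intro j
    constructor
    · intro hj
      have h1 := h _ hj
      rw [Equiv.apply_symm_apply, ← Equiv.eq_symm_apply] at h1
      rwa [← h1]
    · intro hj
      have h1 := h _ hj
      rw [Equiv.apply_symm_apply, eq_comm, ← Equiv.eq_symm_apply] at h1
      rwa [← h1]
  have hocc : occ e p w =
      (Finset.univ.filter fun i => (σ.symm i : ℕ) < p ∧ e (σ.symm i) = w).card :=
    (card_filter_symm_lt σ p.2.le fun s => e s = w).symm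
  rw [hocc, Finset.filter_filter]
  have hmem : ∀ j, τ.symm j ≤ p ↔ j = τ p ∨ σ.symm j < p := by
    intro j
    rw [le_iff_eq_or_lt, Equiv.symm_apply_eq, hlt]
  split_ifs with hw
  · rw [← Finset.card_insert_of_notMem (a := τ p)]
    · congr 1
      ext j
      simp only [Finset.mem_filter, Finset.mem_univ, true_and, Finset.mem_insert, hmem]
      constructor
      · rintro ⟨h1 | h1, h2⟩
        · exact Or.inl h1
        · exact Or.inr ⟨h1, h2⟩
      · rintro (rfl | ⟨h1, h2⟩)
        · exact ⟨Or.inl rfl, hw⟩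
        · exact ⟨Or.inr h1, h2⟩
    · simp only [Finset.mem_filter, Finset.mem_univ, true_and, not_and]
      intro h1
      exact absurd ((hlt (τ p)).2 h1) (by simp)
  · rw [add_zero]
    congr 1
    ext j
    simp only [Finset.mem_filter, Finset.mem_univ, true_and, hmem]
    constructor
    · rintro ⟨rfl | h1, h2⟩
      · exact absurd h2 hw
      · exact ⟨h1, h2⟩
    · rintro ⟨h1, h2⟩
      exact ⟨Or.inr h1, h2⟩

/-- Along τ, the first p + 1 positions carry the first p letters of the word followed by its letter
at q, the σ-position of τ p. A separating word is built so that this prefix violates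
`card_filter_le_mul`, with u the letter at q or u = r + 1. -/
theorem not_subset_of_isSeparating (K : Type*) [Field K] (hanti : Antitone l)
    (hsum : ∑ i, l i = n) (σ τ : Equiv.Perm (Fin n)) (p : Fin n) (h : ∀ i < p, σ i = τ i)
    {r : ℕ} {e : ℕ → ℕ} (he : IsSeparating l n p (σ.symm (τ p)) r e) :
    ¬ leadingExponents (lexOrderOfPerm σ) (spechtIdeal K l n) ⊆
      leadingExponents (lexOrderOfPerm τ) (spechtIdeal K l n) := by
  intro hsub
  obtain ⟨hb, hle, hfull, hpq⟩ := he
  obtain ⟨c, hc, hE⟩ := (mem_leadingExponents_lexOrderOfPerm hanti hsum τ).1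
    (hsub (mem_leadingExponents_of_isBallot K hanti hsum σ hb hle))
  have hcount := card_filter_symm_le σ τ p h e
  have key := card_filter_le_mul hc (fun i j hij => τ.symm.injective (Fin.ext hij)) hE
    (card_filter_symm_eq_rowSum (r := r + 1) σ fun w hw => hfull w (by omega))
    (Finset.univ.filter fun j => τ.symm j ≤ p) (fun i hi j hij => by
      simp only [Finset.mem_filter, Finset.mem_univ, true_and] at hi ⊢
      exact (Fin.lt_def.2 hij).le.trans hi)
  simp only [Finsupp.equivFunOnFinite_symm_apply_apply] at key
  simp only [hcount] at key
  rcases hpq with ⟨h1, h2⟩ | ⟨h1, h2⟩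
  · have h3 := key (e (σ.symm (τ p)))
    rw [h1, if_neg (by omega), Nat.mul_zero, Nat.le_zero, Finset.card_eq_zero,
      Finset.filter_eq_empty_iff] at h3
    exact h3 (x := τ p) (by simp) ⟨by omega, le_rfl⟩
  · have h3 := key (r + 1)
    have h4 := hcount (r + 1)
    rw [if_pos h2] at h4
    rw [if_neg (by omega)] at h3
    have h5 : ∀ x, (r < x ∧ x ≤ r + 1) ↔ x = r + 1 := fun x => by omega
    simp only [h5] at h3
    rw [h4] at h3
    simp at h3
    omega

end Obstruction

/-! ### Choice of rows for a given position -/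

section SeparatingPositions

variable {m n : ℕ} {l : Fin m → ℕ}

theorem mul_le_rowSum {t v : ℕ} (h : ∀ w < t, v ≤ rowLength l w) : t * v ≤ rowSum l t := by
  rw [rowSum_eq_sum_range, ← smul_eq_mul]
  simpa using Finset.card_nsmul_le_sum (Finset.range t) (rowLength l) v
    fun w hw => h w (Finset.mem_range.1 hw)

/-- Apart from one case for two rows, separating words exist for every position `p` that is not
among the last `k + 1`, where `k` is the smallest difference of consecutive row lengths. -/
theorem exists_isSeparating (hanti : Antitone l) (hpos : ∀ i, 0 < l i) (hsum : ∑ i, l i = n)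
    (hm : 2 ≤ m) {k : ℕ} (hgap : ∀ w, w + 1 < m → rowLength l (w + 1) + k ≤ rowLength l w)
    (hk : ∃ w, w + 1 < m ∧ rowLength l w = rowLength l (w + 1) + k) {p q : ℕ}
    (hp : p + k + 1 < n) (hpq : p < q) (hq : q < n) :
    (∃ r e, IsSeparating l n p q r e) ∨ (m = 2 ∧ p = 1 ∧ 2 ≤ rowLength l 1) := by
  have hl := antitone_rowLength hanti
  have hpos' : ∀ w < m, 0 < rowLength l w := fun w hw => rowLength_pos hpos hw
  have hS : ∀ j, rowSum l (j + 1) = rowSum l j + rowLength l j := by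
    intro j
    rw [rowSum_eq_sum_range, rowSum_eq_sum_range, Finset.sum_range_succ]
  have hSm : rowSum l m = n := rowSum_of_le hsum le_rfl
  obtain ⟨M, rfl⟩ : ∃ M, m = M + 2 := ⟨m - 2, by omega⟩
  have hSM := hS M
  have hSM1 : rowSum l (M + 2) = rowSum l (M + 1) + rowLength l (M + 1) := hS (M + 1)
  -- Here row min(p, M) can stay empty before p: it needs only one letter from each earlier row, and
  -- those rows have enough room because all rows are nonempty.
  rcases le_or_gt p (rowSum l M) with hpM | hpM
  · left
    refine ⟨min p M, exists_isSeparating_of_le_rowSum hanti hpos hsum (by omega)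
      (min_le_left _ _) ?_ hpq hq⟩
    rcases le_total p M with h | h
    · rw [min_eq_left h]
      have := mul_le_rowSum (l := l) (t := p) (v := 1) fun w hw => hpos' w (by omega)
      omega
    · rwa [min_eq_right h]
  -- the last pair of consecutive rows whose lengths have difference `k`
  obtain ⟨r, hr, hrmax⟩ : ∃ r, (r + 1 < M + 2 ∧ rowLength l r = rowLength l (r + 1) + k) ∧
      ∀ r', r < r' → r' + 1 < M + 2 → rowLength l r' ≠ rowLength l (r' + 1) + k := by
    obtain ⟨w, hw⟩ := hk
    let P : ℕ → Prop := fun w => w + 1 < M + 2 ∧ rowLength l w = rowLength l (w + 1) + k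
    have h1 : P (Nat.findGreatest P M) := Nat.findGreatest_spec (P := P) (m := w) (by omega) hw
    refine ⟨Nat.findGreatest P M, h1, fun r' h2 h3 h4 => ?_⟩
    exact Nat.findGreatest_is_greatest (P := P) h2 (by omega) ⟨h3, h4⟩
  obtain ⟨hrm, hrk⟩ := hr
  have hSr1 := hS r
  have hSr2 : rowSum l (r + 2) = rowSum l (r + 1) + rowLength l (r + 1) := hS (r + 1)
  have hSr2n : rowSum l (r + 2) ≤ n := by
    rw [← hSm]
    exact rowSum_mono l (by omega)
  have hr1pos := hpos' (r + 1) hrm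
  -- For r = M this follows from rowSum l M < p and p + k + 1 < n. For r < M, a row r + 1 of length
  -- 1 would force k = 0 and a next row of length 1, against the maximality of r.
  have h2 : 2 ≤ rowLength l (r + 1) := by
    by_contra hlt
    rcases (show r ≤ M by omega).eq_or_lt with rfl | hrM
    · omega
    · have h3 := hpos' (r + 2) (by omega)
      have h4 : rowLength l (r + 2) + k ≤ rowLength l (r + 1) := hgap (r + 1) (by omega)
      exact hrmax (r + 1) (by omega) (by omega)
        (show rowLength l (r + 1) = rowLength l (r + 2) + k by omega)
  -- The value v is the least one, at least 2, for which p leaves room to complete row r. That v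
  -- fits in row r + 1 is where p + k + 1 < n and the difference k of the two rows enter.
  by_cases hlow : 2 * r + 2 ≤ p
  · left
    refine ⟨r, exists_isSeparating_of_le hanti hpos hsum (v := max 2 (p + 2 + rowLength l r - n))
      hrm (le_max_left _ _) (by omega) ?_ (by omega) hpq hq⟩
    rcases le_total (p + 2 + rowLength l r - n) 2 with h3 | h3
    · rw [max_eq_left h3]
      omega
    · rw [max_eq_right h3]
      obtain ⟨v, hv⟩ : ∃ v, v = p + 2 + rowLength l r - n := ⟨_, rfl⟩
      rw [← hv] at h3 ⊢
      have h5 := mul_le_rowSum (l := l) (t := r) (v := v) fun w hw => by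
        have := hl (show w ≤ r + 1 by omega)
        omega
      rw [mul_comm] at h5
      omega
  -- Now p ≤ 2r + 1, while all rows up to r + 1 have length at least 2 and p > rowSum l M. This
  -- forces r = M and p = 2r + 1. For r > 0 the previous pair of rows works with v = 2; r = 0 is the
  -- exceptional case.
  · have hrM : r = M := by
      by_contra hne
      have h3 := mul_le_rowSum (l := l) (t := r + 1) (v := 2) fun w hw => by
        have := hl (show w ≤ r + 1 by omega)
        omega
      have h4 := rowSum_mono l (show r + 1 ≤ M by omega)
      omega
    subst hrM
    have h3 := mul_le_rowSum (l := l) (t := r) (v := 2) fun w hw => by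
      have := hl (show w ≤ r + 1 by omega)
      omega
    rcases Nat.eq_zero_or_pos r with rfl | hr0
    · right
      exact ⟨rfl, by omega, h2⟩
    · left
      obtain ⟨r, rfl⟩ : ∃ r', r = r' + 1 := ⟨r - 1, by omega⟩
      have h4 := mul_le_rowSum (l := l) (t := r) (v := 2) fun w hw => by
        have := hl (show w ≤ r + 1 + 1 by omega)
        omega
      have h5 := hS r
      have h6 := hl (show r + 1 ≤ r + 1 + 1 by omega)
      exact ⟨r, exists_isSeparating_of_le hanti hpos hsum (v := 2) (by omega) le_rfl (by omega)
        (by omega) (by omega) hpq hq⟩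

end SeparatingPositions

/-! ### The exceptional position for two rows -/

section TwoRows

variable {n : ℕ} {l : Fin 2 → ℕ}

/-- For two rows, there is a ballot word of shape `l` with the letter `1` at positions `y < z`. -/
theorem exists_isBallot_two_rows (hanti : Antitone l) (hsum : ∑ i, l i = n)
    (hl : 2 ≤ rowLength l 1) {y z : ℕ} (hy : 1 ≤ y) (hyz : y < z) (hz : 3 ≤ z) (hzn : z < n) :
    ∃ e, IsBallot e n ∧ (∀ w, occ e n w = rowLength l w) ∧ e y = 1 ∧ e z = 1 := by
  set a := rowLength l 0 with ha
  have hn : n = a + rowLength l 1 := by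
    rw [← hsum, ha, rowLength_of_lt l (by omega), rowLength_of_lt l (by omega), Fin.sum_univ_two]
    rfl
  have hla : rowLength l 1 ≤ a := antitone_rowLength hanti (by omega)
  -- `g t` is the number of the forced positions y, z before t; apart from them, the word is all 0s
  -- followed by all 1s. The condition 3 ≤ z leaves two 0s before the second forced 1.
  obtain ⟨g, hg⟩ : ∃ g : ℕ → ℕ, ∀ t, (t ≤ y ∧ g t = 0) ∨ (y < t ∧ t ≤ z ∧ g t = 1) ∨
      (z < t ∧ g t = 2) := by
    refine ⟨fun t => if t ≤ y then 0 else if t ≤ z then 1 else 2, fun t => ?_⟩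
    rcases le_or_gt t y with h1 | h1
    · exact Or.inl ⟨h1, if_pos h1⟩
    rcases le_or_gt t z with h2 | h2
    · exact Or.inr (Or.inl ⟨h1, h2, by simp [h2, h1.not_ge]⟩)
    · exact Or.inr (Or.inr ⟨h2, by simp [h2.not_ge, h1.not_ge]⟩)
  obtain ⟨e, he⟩ : ∃ e : ℕ → ℕ, ∀ t, ((t = y ∨ t = z) ∧ e t = 1) ∨
      (t ≠ y ∧ t ≠ z ∧ t < a + g t ∧ e t = 0) ∨ (t ≠ y ∧ t ≠ z ∧ a + g t ≤ t ∧ e t = 1) := by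
    refine ⟨fun t => if t = y ∨ t = z then 1 else if t < a + g t then 0 else 1, fun t => ?_⟩
    by_cases h1 : t = y ∨ t = z
    · exact Or.inl ⟨h1, if_pos h1⟩
    have h2 := not_or.1 h1
    rcases lt_or_ge t (a + g t) with h3 | h3
    · exact Or.inr (Or.inl ⟨h2.1, h2.2, h3, by simp only [if_neg h1, if_pos h3]⟩)
    · exact Or.inr (Or.inr ⟨h2.1, h2.2, h3, by simp only [if_neg h1, if_neg h3.not_gt]⟩)
  have hocc : ∀ t, occ e t 0 = min (t - g t) a ∧ occ e t 1 = t - min (t - g t) a := by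
    intro t
    induction t with
    | zero => simp [occ_zero]
    | succ t ih =>
      rw [occ_succ, occ_succ, ih.1, ih.2]
      have h1 := hg t
      have h2 := hg (t + 1)
      rcases he t with ⟨h3, h4⟩ | ⟨h3, h3', h5, h4⟩ | ⟨h3, h3', h5, h4⟩ <;> rw [h4] <;> simp <;>
        omega
  have hocc2 : ∀ t w, occ e t (w + 2) = 0 := by
    intro t w
    rw [occ, Finset.card_eq_zero, Finset.filter_eq_empty_iff]
    intro s _
    have := he s
    omega
  refine ⟨e, fun t ht => antitone_nat_of_succ_le fun w => ?_, fun w => ?_, ?_, ?_⟩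
  · rcases w with _ | w
    · rw [zero_add, (hocc t).1, (hocc t).2]
      have := hg t
      omega
    · rw [hocc2]
      exact Nat.zero_le _
  · have := hg n
    rcases w with _ | _ | w
    · rw [(hocc n).1]
      omega
    · rw [zero_add, (hocc n).2]
      omega
    · rw [hocc2, rowLength_of_le l (by omega)]
  · have := he y
    omega
  · have := he z
    omega

/-- For two rows, there is a ballot word of dominated shape starting with `0, 1, 2`. -/
theorem exists_isBallot_hook (hsum : ∑ i, l i = n) (hpos : ∀ i, 0 < l i)
    (hl : 2 ≤ rowLength l 1) :
    ∃ e, IsBallot e n ∧ occ e n 0 = rowLength l 0 ∧ occ e n 1 ≤ rowLength l 1 ∧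
      e 0 = 0 ∧ e 1 = 1 ∧ e 2 = 2 := by
  have h0 := rowLength_pos hpos (show 0 < 2 by omega)
  have hn : n = rowLength l 0 + rowLength l 1 := by
    rw [← hsum, rowLength_of_lt l (by omega), rowLength_of_lt l (by omega), Fin.sum_univ_two]
    rfl
  have hocc : ∀ t w, occ (fun i => i) t w = if w < t then 1 else 0 := by
    intro t w
    induction t with
    | zero => simp [occ_zero]
    | succ t ih =>
      rw [occ_succ, ih]
      split_ifs <;> omega
  have hb : IsBallot (fun i => i) 3 := by
    intro t _
    refine antitone_nat_of_succ_le fun w => ?_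
    rw [hocc, hocc]
    split_ifs <;> omega
  let β : ℕ → ℕ := fun w => if w = 0 then rowLength l 0 else if w < rowLength l 1 + 1 then 1 else 0
  have hβ : Antitone β := by
    intro x y hxy
    dsimp only [β]
    split_ifs <;> omega
  have hsβ : ∑ w ∈ Finset.range (rowLength l 1 + 1), β w = n := by
    rw [Finset.sum_range_succ', Finset.sum_congr rfl (g := fun _ => 1) fun w hw => by
      have := Finset.mem_range.1 hw
      dsimp only [β]
      rw [if_neg (by omega), if_pos (by omega)]]
    simp only [Finset.sum_const, Finset.card_range, smul_eq_mul, β]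
    simp
    omega
  obtain ⟨e, h1, -, h2, h3⟩ := exists_extension (N := rowLength l 1 + 1) hβ (fun w hw => by
    dsimp only [β]
    rw [if_neg (by omega), if_neg (by omega)]) hb (fun w => by
    rw [hocc]
    dsimp only [β]
    split_ifs <;> omega)
  rw [hsβ] at h2 h3
  refine ⟨e, h2, h3 0, (h3 1).trans_le ?_, h1 0 (by omega), h1 1 (by omega), h1 2 (by omega)⟩
  dsimp only [β]
  rw [if_neg (by omega), if_pos (by omega)]
  omega

/-- For two rows, the second smallest variable is determined by the leading exponents. -/
theorem not_subset_of_two_rows (K : Type*) [Field K] (hanti : Antitone l) (hpos : ∀ i, 0 < l i)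
    (hsum : ∑ i, l i = n) (hl : 2 ≤ rowLength l 1) (hn : 3 ≤ n) (σ τ : Equiv.Perm (Fin n))
    (h0 : σ ⟨0, by omega⟩ = τ ⟨0, by omega⟩) (h1 : σ ⟨1, by omega⟩ ≠ τ ⟨1, by omega⟩) :
    ¬ leadingExponents (lexOrderOfPerm σ) (spechtIdeal K l n) ⊆
      leadingExponents (lexOrderOfPerm τ) (spechtIdeal K l n) := by
  intro hsub
  set x := τ ⟨0, by omega⟩ with hx
  set b := τ ⟨1, by omega⟩ with hb
  set d := τ ⟨2, by omega⟩ with hd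
  have hxb : x ≠ b := fun h => by simpa using τ.injective h
  have hxd : x ≠ d := fun h => by simpa using τ.injective h
  have hbd : b ≠ d := fun h => by simpa using τ.injective h
  have hσx : (σ.symm x : ℕ) = 0 := by rw [← h0]; simp
  have hinj : ∀ {i j : Fin n}, (σ.symm i : ℕ) = σ.symm j → i = j := fun h =>
    σ.symm.injective (Fin.ext h)
  have hσb0 : (σ.symm b : ℕ) ≠ 0 := fun h => hxb (hinj (hσx.trans h.symm))
  have hσd0 : (σ.symm d : ℕ) ≠ 0 := fun h => hxd (hinj (hσx.trans h.symm))
  have hσbd : (σ.symm b : ℕ) ≠ σ.symm d := fun h => hbd (hinj h)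
  have hσb1 : (σ.symm b : ℕ) ≠ 1 := fun h => h1 (by
    rw [← Equiv.eq_symm_apply]
    exact Fin.ext h.symm)
  have hτ : Function.Injective fun i => (τ.symm i : ℕ) := fun i j h =>
    τ.symm.injective (Fin.ext h)
  have hτx : (τ.symm x : ℕ) = 0 := by simp [hx]
  have hτb : (τ.symm b : ℕ) = 1 := by simp [hb]
  have hτd : (τ.symm d : ℕ) = 2 := by simp [hd]
  have hle2 : ∀ i, (τ.symm i : ℕ) ≤ 2 → i = x ∨ i = b ∨ i = d := by
    intro i hi
    rcases (by omega : (τ.symm i : ℕ) = 0 ∨ (τ.symm i : ℕ) = 1 ∨ (τ.symm i : ℕ) = 2)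
      with h | h | h
    · exact Or.inl (hτ (h.trans hτx.symm))
    · exact Or.inr (Or.inl (hτ (h.trans hτb.symm)))
    · exact Or.inr (Or.inr (hτ (h.trans hτd.symm)))
  -- If σ starts with x, d, b, the hook word bounds the height of d by 1; but along τ both b and d
  -- must lie above x in its column, giving d height at least 2. Otherwise b or d has σ-position at
  -- least 3, so a word can have the letter 1 at both; then the first three positions of τ contain
  -- two 1s and only one 0.
  by_cases hcase : (σ.symm b : ℕ) = 2 ∧ (σ.symm d : ℕ) = 1
  · obtain ⟨e, he, ho0, ho1, e0, e1, e2⟩ := exists_isBallot_hook hsum hpos hl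
    obtain ⟨c, hc, hE⟩ := (mem_leadingExponents_lexOrderOfPerm hanti hsum τ).1
      (hsub (mem_leadingExponents_of_isBallot K hanti hsum σ he fun w hw => by
        rcases (by omega : w = 0 ∨ w = 1) with rfl | rfl
        · exact ho0.le
        · exact ho1))
    have hlt := height_lt_iff hc hτ hE (card_filter_symm_eq_rowSum (r := 1) σ fun w hw => by
      obtain rfl : w = 0 := by omega
      exact ho0)
    simp only [Finsupp.equivFunOnFinite_symm_apply_apply] at hE hlt
    have hEb := hlt b
    have hEd := hlt d
    have hEd' := hE d
    rw [hcase.1, e2] at hEb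
    rw [hcase.2, e1] at hEd hEd'
    obtain ⟨i, hi1, hi2, -⟩ := exists_height_eq hτ (show 0 < height c _ b by omega)
    obtain ⟨j, hj1, hj2, hj3⟩ := exists_height_eq hτ (show 0 < height c _ d by omega)
    have hix : i = x := hτ (show (τ.symm i : ℕ) = τ.symm x by omega)
    have hjx : j = x := by
      rcases hle2 j (by omega) with h | h | h
      · exact h
      · rw [h] at hj3
        omega
      · rw [h] at hj2
        omega
    rw [hix] at hi1
    rw [hjx] at hj1
    have h2 := height_lt_height (ρ := fun i => (τ.symm i : ℕ)) hi1 (by omega)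
    have h3 := height_lt_height (ρ := fun i => (τ.symm i : ℕ)) (hi1.symm.trans hj1) (by omega)
    omega
  · obtain ⟨e, he, ho, eb, ed⟩ : ∃ e, IsBallot e n ∧ (∀ w, occ e n w = rowLength l w) ∧
        e (σ.symm b) = 1 ∧ e (σ.symm d) = 1 := by
      have hbn := (σ.symm b).2
      have hdn := (σ.symm d).2
      rcases lt_or_gt_of_ne hσbd with h | h
      · exact exists_isBallot_two_rows hanti hsum hl (by omega) h (by omega) hdn
      · obtain ⟨e, h2, h3, h4, h5⟩ :=
          exists_isBallot_two_rows hanti hsum hl (by omega) h (by omega) hbn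
        exact ⟨e, h2, h3, h5, h4⟩
    obtain ⟨c, hc, hE⟩ := (mem_leadingExponents_lexOrderOfPerm hanti hsum τ).1
      (hsub (mem_leadingExponents_of_isBallot K hanti hsum σ he fun w _ => (ho w).le))
    have key := card_filter_le_mul hc hτ hE
      (card_filter_symm_eq_rowSum (r := 0 + 1) σ fun w _ => ho w)
      (Finset.univ.filter fun j => (τ.symm j : ℕ) ≤ 2) (fun i hi j hij => by
        simp only [Finset.mem_filter, Finset.mem_univ, true_and] at hi ⊢
        exact hij.le.trans hi) 1
    simp only [Finsupp.equivFunOnFinite_symm_apply_apply, tsub_zero, one_mul] at key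
    have h2 : ({b, d} : Finset (Fin n)) ⊆ (Finset.univ.filter fun j => (τ.symm j : ℕ) ≤ 2).filter
        fun i => 0 < e (σ.symm i) ∧ e (σ.symm i) ≤ 1 := by
      intro i hi
      simp only [Finset.mem_insert, Finset.mem_singleton] at hi
      rcases hi with rfl | rfl
      · simp [hτb, eb]
      · simp [hτd, ed]
    have h3 : ((Finset.univ.filter fun j => (τ.symm j : ℕ) ≤ 2).filter
        fun i => e (σ.symm i) = 0) ⊆ {x} := by
      intro i hi
      simp only [Finset.mem_filter, Finset.mem_univ, true_and] at hi
      rcases hle2 i hi.1 with h | h | h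
      · simp [h]
      · rw [h, eb] at hi
        omega
      · rw [h, ed] at hi
        omega
    have h4 := Finset.card_le_card h2
    have h5 := Finset.card_le_card h3
    rw [Finset.card_pair hbd] at h4
    rw [Finset.card_singleton] at h5
    omega

end TwoRows

/-! ### Counting permutations, and the main theorem -/

/-- τ agrees with σ on `p` exactly if σ⁻¹τ fixes `p` pointwise, that is, comes from a permutation of
the complement. -/
theorem card_filter_perm_agree {α : Type*} [Fintype α] [DecidableEq α] (p : α → Prop)
    [DecidablePred p] (σ : Equiv.Perm α) :
    (Finset.univ.filter fun τ : Equiv.Perm α => ∀ a, p a → τ a = σ a).card =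
      (Fintype.card {a // ¬ p a}).factorial := by
  rw [← Fintype.card_perm, ← Fintype.card_subtype]
  refine Fintype.card_congr (Equiv.trans ?_ (Equiv.Perm.subtypeEquivSubtypePerm _).symm)
  refine (Equiv.mulLeft σ⁻¹).subtypeEquiv fun τ => forall_congr' fun a => ?_
  rw [not_not, Equiv.coe_mulLeft, Equiv.Perm.mul_apply, Equiv.Perm.inv_eq_iff_eq, eq_comm]

theorem card_not_add_lt {n j : ℕ} (hj : j ≤ n) :
    Fintype.card {i : Fin n // ¬ (i : ℕ) + j < n} = j := by
  have h := Fintype.card_subtype_compl fun i : Fin n => (i : ℕ) + j < n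
  have h2 : Fintype.card {i : Fin n // (i : ℕ) + j < n} = n - j := by
    rw [Fintype.card_subtype]
    rw [show (Finset.univ.filter fun i : Fin n => (i : ℕ) + j < n) =
      Finset.univ.filter fun i : Fin n => (i : ℕ) < n - j from
        Finset.filter_congr fun i _ => by omega, Fin.card_filter_val_lt]
    omega
  rw [h, h2, Fintype.card_fin]
  omega

/-- If two permutations have the same image under `φ` if and only if they agree away from the last
`j` positions, then `φ` takes `n! / j!` values. -/
theorem encard_range_of_agree {β : Type*} {n j : ℕ} (hj : j ≤ n) (φ : Equiv.Perm (Fin n) → β)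
    (h : ∀ σ τ, φ σ = φ τ ↔ ∀ i : Fin n, (i : ℕ) + j < n → σ i = τ i) :
    (Set.range φ).encard = ((n.factorial / j.factorial : ℕ) : ℕ∞) := by
  classical
  have h1 := Finset.card_eq_sum_card_image φ Finset.univ
  rw [Finset.sum_congr rfl (g := fun _ => j.factorial), Finset.sum_const, Finset.card_univ,
    Fintype.card_perm, Fintype.card_fin, smul_eq_mul] at h1
  · rw [h1, Nat.mul_div_cancel _ (Nat.factorial_pos j), ← Set.encard_coe_eq_coe_finsetCard,
      Finset.coe_image, Finset.coe_univ, Set.image_univ]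
  · intro b hb
    obtain ⟨σ, -, rfl⟩ := Finset.mem_image.1 hb
    simp only [h]
    refine Eq.trans ?_ ((card_filter_perm_agree (fun i : Fin n => (i : ℕ) + j < n) σ).trans
      (by rw [card_not_add_lt hj]))
    congr

section Main

variable {m n k : ℕ} {l : Fin m → ℕ}

/-- At the first disagreement p, the variable τ p has σ-position beyond p, since the earlier
positions agree. Either a separating word or the two-row argument then contradicts the inclusion. -/
theorem agree_of_leadingExponents_subset (K : Type*) [Field K] (hanti : Antitone l)
    (hpos : ∀ i, 0 < l i) (hsum : ∑ i, l i = n) (hm : 2 ≤ m)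
    (hgap : ∀ w, w + 1 < m → rowLength l (w + 1) + k ≤ rowLength l w)
    (hk : ∃ w, w + 1 < m ∧ rowLength l w = rowLength l (w + 1) + k) {σ τ : Equiv.Perm (Fin n)}
    (hsub : leadingExponents (lexOrderOfPerm σ) (spechtIdeal K l n) ⊆
      leadingExponents (lexOrderOfPerm τ) (spechtIdeal K l n)) (i : Fin n)
    (hi : (i : ℕ) + k + 1 < n) : σ i = τ i := by
  induction i using WellFoundedLT.induction with
  | ind p ih =>
    by_contra hne
    have hlow : ∀ i < p, σ i = τ i := fun i h => ih i h (by have := Fin.lt_def.1 h; omega)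
    have hq : p < σ.symm (τ p) := by
      refine lt_of_not_ge fun hle => ?_
      rcases hle.eq_or_lt with h | h
      · exact hne ((Equiv.symm_apply_eq σ).1 h).symm
      · have h2 := hlow _ h
        rw [Equiv.apply_symm_apply] at h2
        exact h.ne (τ.injective h2.symm)
    rcases exists_isSeparating hanti hpos hsum hm hgap hk hi hq (σ.symm (τ p)).2 with
      ⟨r, e, he⟩ | ⟨rfl, hp, h2⟩
    · exact not_subset_of_isSeparating K hanti hsum σ τ p hlow he hsub
    · have hp' : p = ⟨1, by omega⟩ := Fin.ext hp
      exact not_subset_of_two_rows K hanti hpos hsum h2 (by omega) σ τ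
        (hlow _ (Fin.lt_def.2 (hp.symm ▸ zero_lt_one))) (hp' ▸ hne) hsub

end Main

theorem theorem3p3 {K : Type*} [Field K] (m n k : ℕ) (l : Fin m → ℕ)
    (hanti : Antitone l) (hpos : ∀ i, 0 < l i) (hsum : ∑ i, l i = n) (hm : 2 ≤ m)
    (hk : IsLeast {d : ℕ | ∃ (i : ℕ) (h : i + 1 < m),
      l ⟨i, (Nat.lt_succ_self i).trans h⟩ = l ⟨i + 1, h⟩ + d} k) :
    -- the number of initial ideals under all monomial orders
    {J : Ideal (MvPolynomial (Fin n) K) | ∃ M : MonomialOrder.{0, 0} (Fin n),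
        J = initialIdeal M (spechtIdeal K l n)}.encard
      = ((n.factorial / (k + 1).factorial : ℕ) : ℕ∞) ∧
    -- the same initial ideals arise from the lexicographic orders given by permutations
    {J : Ideal (MvPolynomial (Fin n) K) | ∃ M : MonomialOrder.{0, 0} (Fin n),
        J = initialIdeal M (spechtIdeal K l n)}
      = {J : Ideal (MvPolynomial (Fin n) K) | ∃ σ : Equiv.Perm (Fin n),
          J = initialIdeal (lexOrderOfPerm σ) (spechtIdeal K l n)} ∧
    -- the lexicographic initial ideal determines `σ` exactly up to permuting its last
    -- `k + 1` values
    ∀ σ τ : Equiv.Perm (Fin n),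
      initialIdeal (lexOrderOfPerm σ) (spechtIdeal K l n)
          = initialIdeal (lexOrderOfPerm τ) (spechtIdeal K l n) ↔
        ∀ i : Fin n, (i : ℕ) + k + 1 < n → σ i = τ i := by
  obtain ⟨⟨w, hw, hwk⟩, hmin⟩ := hk
  have hgap : ∀ (i : ℕ) (h : i + 1 < m), l ⟨i + 1, h⟩ + k ≤ l ⟨i, by omega⟩ := by
    intro i h
    have h1 : l ⟨i + 1, h⟩ ≤ l ⟨i, by omega⟩ := hanti (Fin.le_def.2 (Nat.le_succ i))
    have h2 : k ≤ l ⟨i, by omega⟩ - l ⟨i + 1, h⟩ := hmin ⟨i, h, (Nat.add_sub_cancel' h1).symm⟩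
    omega
  have hkn : k + 1 ≤ n := by
    have h1 : l ⟨w, by omega⟩ ≤ n :=
      hsum ▸ Finset.single_le_sum (fun i _ => Nat.zero_le (l i)) (Finset.mem_univ _)
    have h2 := hpos ⟨w + 1, hw⟩
    omega
  have key : ∀ σ τ : Equiv.Perm (Fin n),
      initialIdeal (lexOrderOfPerm σ) (spechtIdeal K l n)
          = initialIdeal (lexOrderOfPerm τ) (spechtIdeal K l n) ↔
        ∀ i : Fin n, (i : ℕ) + k + 1 < n → σ i = τ i := by
    intro σ τ
    rw [initialIdeal_eq_iff]
    constructor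
    · intro h
      refine agree_of_leadingExponents_subset K hanti hpos hsum hm (fun v hv => ?_)
        ⟨w, hw, ?_⟩ h.subset
      · rw [rowLength_of_lt l hv, rowLength_of_lt l (by omega)]
        exact hgap v hv
      · rw [rowLength_of_lt l hw, rowLength_of_lt l (by omega)]
        exact hwk
    · exact fun h => leadingExponents_eq_of_subset
        (leadingExponents_subset_of_agree hanti hsum hgap h)
  have hset : {J : Ideal (MvPolynomial (Fin n) K) | ∃ M : MonomialOrder.{0, 0} (Fin n),
        J = initialIdeal M (spechtIdeal K l n)}
      = {J : Ideal (MvPolynomial (Fin n) K) | ∃ σ : Equiv.Perm (Fin n),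
          J = initialIdeal (lexOrderOfPerm σ) (spechtIdeal K l n)} := by
    ext J
    constructor
    · rintro ⟨M, rfl⟩
      obtain ⟨σ, hσ⟩ := exists_sortsVariables M
      exact ⟨σ, initialIdeal_spechtIdeal_eq hanti hsum hσ⟩
    · rintro ⟨σ, rfl⟩
      exact ⟨lexOrderOfPerm σ, rfl⟩
  refine ⟨?_, hset, key⟩
  rw [hset, ← encard_range_of_agree hkn _ key]
  congr 1
  ext J
  exact exists_congr fun σ => eq_comm
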